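/- **Setting.** Let $S=(S_n)_{n\ge 0}$, $S_n=S_0+X_1+\dots+X_n$, be a random walk on $\mathbb R^d$ with i.i.d. increments. Let $\mathcal Z$ be the smallest closed subgroup of $\mathbb R^d$ that contains the topological support of the law of $X_1$. Regard $S$ as a Markov chain on $\mathcal Z$, with law $\mathbb P_x$ when $S_0=x\in\mathcal Z$, and let $\lambda$ be a Haar measure on $\mathcal Z$ (the choice of normalization is immaterial). The walk is *topologically recurrent* if $\mathbb P_0(S_n\in G \text{ for infinitely many } n)=1$ for every open neighbourhood $G$ of $0$ in $\mathcal Z$. For a Borel set $A\subset\mathcal Z$ put $A^c=\mathcal Z\setminus A$ and $T=\inf\{k\ge 1: S_{k-1}\in A^c,\ S_k\in A\}$, and let $\dagger$ be an additional (cemetery) state, with $S_T=S_{T-1}=\dagger$ when $T=\infty$. * The *entrance chain* $S^{\rangle A}$ is the Markov chain on $A\cup\{\dagger\}$ with transition kernel $P^{entr}_A(x,\cdot)=\mathbb P_x(S_T\in\cdot)$ for $x\in A$, and $\dagger$ absorbing. * The *exit chain* $S^{A^c\rangle}$ is the Markov chain on $A^c\cup\{\dagger\}$ with transition kernel $P^{exit}_{A^c}(x,\cdot)=\int_A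 \mathbb P_z(S_{T-1}\in\cdot)\,\mathbb P_x(S_1\in dz\mid S_1\in A)$ for $x\in A^c$ with $\mathbb P_x(S_1\in A)>0$, $P^{exit}_{A^c}(x,\{\dagger\})=1$ for the other $x\in A^c$, and $\dagger$ absorbing. * $\lambda_A^{entr}(B)=\int_{A^c}\mathbb P_x(S_1\in B)\,\lambda(dx)$ for Borel $B\subset A$, and $\lambda_{A^c}^{exit}(B)=\int_B\mathbb P_x(S_1\in A)\,\lambda(dx)$ for Borel $B\subset A^c$. Let $Y$ be a Markov chain on $E\cup\{\dagger\}$ with transition kernel $P$, where $E\in\{A,A^c\}$ carries the subspace topology. A Borel measure $\nu$ on $E$ is *locally finite* if every point of $E$ has a neighbourhood in $E$ of finite measure. It is *invariant* for $Y$ if $\int_E P(x,B)\,\nu(dx)=\nu(B)$ for all Borel $B\subset E$. It is *recurrent* if for every Borel $B\subset E$ with $\nu(B)<\infty$ and $\nu$-a.e. $x\in B$, the chain started at $x$ a.s. visits $B$ at some time $n\ge1$. It is *ergodic* if the shift on path space $(E\cup\{\dagger\})^{\mathbb N_0}$ preserves, and is ergodic with respect to, the (possibly infinite) law of the chain started under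 $\nu$. **Theorem 5.2.** Let $S$ be a topologically recurrent random walk on $\mathbb R^d$, and let $A\subset\mathcal Z$ be a Borel set with $\lambda(A)>0$, $\lambda(A^c)>0$ and $\lambda(\partial A)=0$, where $\partial A$ is the boundary of $A$ in $\mathcal Z$. Then: 1. $\lambda_A^{entr}$ is a non-zero locally finite invariant Borel measure on $A$ for the entrance chain $S^{\rangle A}$; every locally finite Borel measure on $A$ that is invariant for $S^{\rangle A}$ equals $c\,\lambda_A^{entr}$ for some $c\in[0,\infty)$; and $\lambda_A^{entr}$ is recurrent and ergodic for $S^{\rangle A}$. 2. $\lambda_{A^c}^{exit}$ is a non-zero locally finite invariant Borel measure on $A^c$ for the exit chain $S^{A^c\rangle}$; every locally finite Borel measure on $A^c$ that is invariant for $S^{A^c\rangle}$ equals $c\,\lambda_{A^c}^{exit}$ for some $c\in[0,\infty)$; and $\lambda_{A^c}^{exit}$ is recurrent and ergodic for $S^{A^c\rangle}$. -/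

import Mathlib

open MeasureTheory ProbabilityTheory Set
open scoped ENNReal NNReal

noncomputable section

namespace EntranceExit

/-! ### Time-homogeneous Markov chains -/

section Chain

variable {E : Type*} [MeasurableSpace E]

/-- The law `ℙ_x` on path space `ℕ → E` of the time-homogeneous Markov chain with transition
kernel `P` started at `x` (Ionescu-Tulcea): the law of the state at time `n + 1` given
the states up to time `n` is `P` evaluated at the state at time `n`. -/
def chainLaw (P : Kernel E E) [IsMarkovKernel P] : Kernel E (ℕ → E) :=
  (Kernel.traj (X := fun _ => E)
    (fun n => P.comap (fun h : (Π _ : Finset.Iic n, E) => h ⟨n, Finset.mem_Iic.2 le_rfl⟩)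
      (measurable_pi_apply _)) 0).comap
    (fun x _ => x) (measurable_pi_lambda _ fun _ => measurable_id)

instance (P : Kernel E E) [IsMarkovKernel P] : IsMarkovKernel (chainLaw P) := by
  unfold chainLaw; infer_instance

/-- The one-sided shift on path space. -/
def shift (ω : ℕ → E) : ℕ → E := fun n => ω (n + 1)

end Chain

/-! ### Measures on `E` for chains on `E ∪ {†}`

The space `E ∪ {†}` is modelled by `E ⊕ Unit`, the cemetery state being `Sum.inr ()`;
a subset is measurable iff its trace on `E` is. -/

section Cemetery

variable {E : Type*} [MeasurableSpace E]

/-- `ν` is invariant: `∫_E P(x, B) ν(dx) = ν(B)` for every measurable `B ⊆ E`. -/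
def IsInvariant (P : Kernel (E ⊕ Unit) (E ⊕ Unit)) (ν : Measure E) : Prop :=
  ∀ B : Set E, MeasurableSet B → ∫⁻ x, P (Sum.inl x) (Sum.inl '' B) ∂ν = ν B

/-- `ν` is recurrent: for every measurable `B ⊆ E` with `ν(B) < ∞`, for `ν`-a.e. `x ∈ B` the chain
started at `x` almost surely visits `B` at some time `n ≥ 1`. -/
def IsRecurrent (P : Kernel (E ⊕ Unit) (E ⊕ Unit)) [IsMarkovKernel P] (ν : Measure E) : Prop :=
  ∀ B : Set E, MeasurableSet B → ν B < ∞ →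
    ∀ᵐ x ∂ν, x ∈ B → ∀ᵐ ω ∂(chainLaw P (Sum.inl x)), ∃ n : ℕ, 1 ≤ n ∧ ω n ∈ Sum.inl '' B

/-- `ν` is ergodic: the shift preserves the (possibly infinite) law `∫ ℙ_x ν(dx)` of the chain
started under `ν`, and it is ergodic for this law. -/
def IsErgodic (P : Kernel (E ⊕ Unit) (E ⊕ Unit)) [IsMarkovKernel P] (ν : Measure E) : Prop :=
  Ergodic shift ((ν.map Sum.inl).bind (chainLaw P))

/-- `ν` is, up to a constant factor, the unique locally finite invariant Borel measure: it is
itself non-zero, locally finite and invariant, and every locally finite invariant measure is a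
finite multiple of it. -/
structure IsUniquelyInvariant [TopologicalSpace E] (P : Kernel (E ⊕ Unit) (E ⊕ Unit))
    (ν : Measure E) : Prop where
  ne_zero : ν ≠ 0
  locallyFinite : IsLocallyFiniteMeasure ν
  invariant : IsInvariant P ν
  unique : ∀ η : Measure E, IsLocallyFiniteMeasure η → IsInvariant P η → ∃ c : ℝ≥0, η = c • ν

end Cemetery

/-! ### Entrance and exit chains -/

section EntranceExit

variable {X : Type*} [MeasurableSpace X]

open Classical in
/-- Position at the first entrance time `T = inf {k ≥ 1 : ω (k-1) ∈ Aᶜ, ω k ∈ A}`, and `†` if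
`T = ∞`. (Below `Nat.find h = T - 1`.) -/
def firstEntrance (A : Set X) (ω : ℕ → X) : A ⊕ Unit :=
  if h : ∃ k, ω k ∈ Aᶜ ∧ ω (k + 1) ∈ A then
    Sum.inl ⟨ω (Nat.find h + 1), (Nat.find_spec h).2⟩
  else Sum.inr ()

open Classical in
/-- Position at time `T - 1`, just before the first entrance time `T` from `Aᶜ` to `A`,
and `†` if `T = ∞`. -/
def firstExit (A : Set X) (ω : ℕ → X) : ↥Aᶜ ⊕ Unit :=
  if h : ∃ k, ω k ∈ Aᶜ ∧ ω (k + 1) ∈ A then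
    Sum.inl ⟨ω (Nat.find h), (Nat.find_spec h).1⟩
  else Sum.inr ()

theorem measurableSet_cross {A : Set X} (hA : MeasurableSet A) (k : ℕ) :
    MeasurableSet {ω : ℕ → X | ω k ∈ Aᶜ ∧ ω (k + 1) ∈ A} :=
  ((measurable_pi_apply (X := fun _ => X) k) hA.compl).inter
    ((measurable_pi_apply (X := fun _ => X) (k + 1)) hA)

theorem measurable_crossAux {A : Set X} (hA : MeasurableSet A) {F : Type*} [MeasurableSpace F]
    (f : (ℕ → X) → F ⊕ Unit) (g : ℕ → (ℕ → X) → X) (hg : ∀ k, Measurable (g k))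
    (e : F → X) (he : MeasurableEmbedding e)
    (h1 : ∀ ω k, (ω k ∈ Aᶜ ∧ ω (k + 1) ∈ A) → (∀ j < k, ¬ (ω j ∈ Aᶜ ∧ ω (j + 1) ∈ A)) →
      ∃ y : F, f ω = Sum.inl y ∧ e y = g k ω)
    (h2 : ∀ ω, (¬ ∃ k, ω k ∈ Aᶜ ∧ ω (k + 1) ∈ A) → f ω = Sum.inr ()) :
    Measurable f := by
  classical
  intro s hs
  have hs1 : MeasurableSet (Sum.inl ⁻¹' s : Set F) := measurable_inl hs
  have hc := measurableSet_cross hA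
  have key : f ⁻¹' s =
      (⋃ k, ({ω : ℕ → X | ω k ∈ Aᶜ ∧ ω (k + 1) ∈ A} ∩
        (⋂ j, ⋂ (_ : j < k), {ω : ℕ → X | ω j ∈ Aᶜ ∧ ω (j + 1) ∈ A}ᶜ)) ∩
        g k ⁻¹' (e '' (Sum.inl ⁻¹' s))) ∪
      ((⋃ k, {ω : ℕ → X | ω k ∈ Aᶜ ∧ ω (k + 1) ∈ A})ᶜ ∩ {_ω | (Sum.inr () : F ⊕ Unit) ∈ s}) := by
    ext ω
    by_cases h : ∃ k, ω k ∈ Aᶜ ∧ ω (k + 1) ∈ A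
    · constructor
      · intro hω
        obtain ⟨y, hy, hy'⟩ := h1 ω (Nat.find h) (Nat.find_spec h) (fun j hj => Nat.find_min h hj)
        refine Or.inl (mem_iUnion.2 ⟨Nat.find h, ⟨Nat.find_spec h, ?_⟩, ⟨y, ?_, hy'⟩⟩)
        · exact mem_iInter₂.2 fun j hj => Nat.find_min h hj
        · have : f ω ∈ s := hω
          rwa [hy] at this
      · rintro (hω | hω)
        · obtain ⟨k, ⟨hk, hj⟩, z, hz, hz'⟩ := mem_iUnion.1 hω
          obtain ⟨y, hy, hy'⟩ := h1 ω k hk (fun j hjk => mem_iInter₂.1 hj j hjk)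
          have : y = z := he.injective (hy'.trans hz'.symm)
          subst this
          change f ω ∈ s
          rw [hy]; exact hz
        · exact absurd (mem_iUnion.2 h) hω.1
    · have hf := h2 ω h
      constructor
      · intro hω
        have : f ω ∈ s := hω
        rw [hf] at this
        exact Or.inr ⟨fun hh => h (mem_iUnion.1 hh), this⟩
      · rintro (hω | hω)
        · obtain ⟨k, ⟨hk, _⟩, _⟩ := mem_iUnion.1 hω
          exact absurd ⟨k, hk⟩ h
        · change f ω ∈ s
          rw [hf]; exact hω.2
  rw [key]
  refine MeasurableSet.union (MeasurableSet.iUnion fun k => ?_) ?_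
  · exact ((hc k).inter (MeasurableSet.iInter fun j => MeasurableSet.iInter fun _ =>
      (hc j).compl)).inter (hg k (he.measurableSet_image.2 hs1))
  · exact (MeasurableSet.iUnion hc).compl.inter (MeasurableSet.const _)

theorem measurable_firstEntrance {A : Set X} (hA : MeasurableSet A) :
    Measurable (firstEntrance A) := by
  classical
  refine measurable_crossAux hA _ (fun k ω => ω (k + 1)) (fun k => measurable_pi_apply _)
    Subtype.val (MeasurableEmbedding.subtype_coe hA) ?_ ?_
  · intro ω k hk hj
    have h : ∃ k, ω k ∈ Aᶜ ∧ ω (k + 1) ∈ A := ⟨k, hk⟩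
    have hkf : Nat.find h = k := (Nat.find_eq_iff h).2 ⟨hk, hj⟩
    refine ⟨⟨ω (Nat.find h + 1), (Nat.find_spec h).2⟩, ?_, congrArg (fun n => ω (n + 1)) hkf⟩
    unfold firstEntrance
    rw [dif_pos h]
  · intro ω h
    exact dif_neg h

theorem measurable_firstExit {A : Set X} (hA : MeasurableSet A) :
    Measurable (firstExit A) := by
  classical
  refine measurable_crossAux hA _ (fun k ω => ω k) (fun k => measurable_pi_apply _)
    Subtype.val (MeasurableEmbedding.subtype_coe hA.compl) ?_ ?_
  · intro ω k hk hj
    have h : ∃ k, ω k ∈ Aᶜ ∧ ω (k + 1) ∈ A := ⟨k, hk⟩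
    have hkf : Nat.find h = k := (Nat.find_eq_iff h).2 ⟨hk, hj⟩
    refine ⟨⟨ω (Nat.find h), (Nat.find_spec h).1⟩, ?_, congrArg ω hkf⟩
    unfold firstExit
    rw [dif_pos h]
  · intro ω h
    exact dif_neg h

variable (P : Kernel X X) [IsMarkovKernel P] {A : Set X}

/-- Transition kernel on `A ∪ {†}` of the entrance chain into `A` from `Aᶜ`: from `x ∈ A` it is the
law under `ℙ_x` of the position at the first entrance; `†` is absorbing. -/
def entranceKernel (hA : MeasurableSet A) : Kernel (A ⊕ Unit) (A ⊕ Unit) where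
  toFun := Sum.elim (fun x => (chainLaw P x.1).map (firstEntrance A))
    (fun _ => Measure.dirac (Sum.inr ()))
  measurable' := Measurable.sumElim
    ((Measure.measurable_map _ (measurable_firstEntrance hA)).comp
      ((chainLaw P).measurable.comp measurable_subtype_coe)) measurable_const

instance (hA : MeasurableSet A) : IsMarkovKernel (entranceKernel P hA) := by
  constructor
  rintro (x | x)
  · exact Measure.isProbabilityMeasure_map (measurable_firstEntrance hA).aemeasurable
  · exact Measure.dirac.isProbabilityMeasure

/-- The law under `ℙ_z` of the first exit position from `Aᶜ` to `A`. -/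
def firstExitKernel (hA : MeasurableSet A) : Kernel X (↥Aᶜ ⊕ Unit) where
  toFun := fun z => (chainLaw P z).map (firstExit A)
  measurable' := (Measure.measurable_map _ (measurable_firstExit hA)).comp (chainLaw P).measurable

instance (hA : MeasurableSet A) : IsMarkovKernel (firstExitKernel P hA) :=
  ⟨fun _ => Measure.isProbabilityMeasure_map (measurable_firstExit hA).aemeasurable⟩

open Classical in
/-- Transition kernel on `Aᶜ ∪ {†}` of the exit chain from `Aᶜ` to `A`: from `x ∈ Aᶜ` with
`P(x, A) > 0` one first samples `z` from `P(x, ·)` conditioned on `A`, and then takes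
the first exit position of the chain started at `z`; from the other `x ∈ Aᶜ` it jumps to `†`, and `†`
is absorbing. -/
def exitKernel (hA : MeasurableSet A) : Kernel (↥Aᶜ ⊕ Unit) (↥Aᶜ ⊕ Unit) where
  toFun := Sum.elim
    (fun x => if P x.1 A = 0 then Measure.dirac (Sum.inr ())
      else (cond (P x.1) A).bind (firstExitKernel P hA))
    (fun _ => Measure.dirac (Sum.inr ()))
  measurable' := by
    refine Measurable.sumElim ?_ measurable_const
    refine Measurable.comp (g := fun x : X => if P x A = 0 then Measure.dirac (Sum.inr ())
      else (cond (P x) A).bind (firstExitKernel P hA)) ?_ measurable_subtype_coe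
    have hPA : Measurable fun x => P x A := P.measurable_coe hA
    refine Measurable.ite (hPA (measurableSet_singleton 0)) measurable_const ?_
    refine (Measure.measurable_bind' (firstExitKernel P hA).measurable).comp ?_
    refine Measure.measurable_of_measurable_coe _ fun s hs => ?_
    simp only [cond_apply hA]
    exact hPA.inv.mul (P.measurable_coe (hA.inter hs))

instance (hA : MeasurableSet A) : IsMarkovKernel (exitKernel P hA) := by
  constructor
  rintro (x | x)
  · change IsProbabilityMeasure (if P x.1 A = 0 then _ else _)
    split_ifs with h
    · exact Measure.dirac.isProbabilityMeasure
    · have := cond_isProbabilityMeasure h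
      infer_instance
  · exact Measure.dirac.isProbabilityMeasure

/-- The measure `μ_A^entr = ∫_{Aᶜ} ℙ_x(Y₁ ∈ ·) μ(dx)` on `A`. -/
def entranceMeasure (μ : Measure X) (A : Set X) : Measure A :=
  ((μ.restrict Aᶜ).bind P).comap Subtype.val

/-- The measure `μ_{Aᶜ}^exit(dx) = ℙ_x(Y₁ ∈ A) μ(dx)` on `Aᶜ`. -/
def exitMeasure (μ : Measure X) (A : Set X) : Measure ↥Aᶜ :=
  (μ.withDensity fun x => P x A).comap Subtype.val

end EntranceExit

/-! ### Random walks on `ℝ^d` -/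

section RandomWalk

variable {d : ℕ} (ρ : Measure (EuclideanSpace ℝ (Fin d)))

/-- The state space of the random walk with step distribution `ρ`: the minimal closed subgroup of
`ℝ^d` that contains the topological support of `ρ`. -/
def stateSpace : AddSubgroup (EuclideanSpace ℝ (Fin d)) :=
  (AddSubgroup.closure ρ.support).topologicalClosure

/-- The step distribution, as a measure on the state space. -/
def stepLaw : Measure (stateSpace ρ) := ρ.comap Subtype.val

theorem measurableSet_stateSpace :
    MeasurableSet (stateSpace ρ : Set (EuclideanSpace ℝ (Fin d))) :=
  (AddSubgroup.isClosed_topologicalClosure _).measurableSet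

instance [IsProbabilityMeasure ρ] : IsProbabilityMeasure (stepLaw ρ) := by
  constructor
  have h1 : ρ (stateSpace ρ : Set (EuclideanSpace ℝ (Fin d)))ᶜ = 0 := by
    refine measure_mono_null (compl_subset_compl.2 ?_) (Measure.support_mem_ae (μ := ρ))
    exact AddSubgroup.subset_closure.trans (AddSubgroup.le_topologicalClosure _)
  have h2 : stepLaw ρ univ = ρ (stateSpace ρ : Set (EuclideanSpace ℝ (Fin d))) := by
    unfold stepLaw
    refine (MeasurableEmbedding.comap_apply
      (MeasurableEmbedding.subtype_coe (measurableSet_stateSpace ρ)) ρ univ).trans ?_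
    rw [image_univ]
    exact congrArg ρ Subtype.range_coe
  rw [h2]
  exact (prob_compl_eq_zero_iff (measurableSet_stateSpace ρ)).1 h1

/-- The transition kernel `x ↦ law of x + X₁` of the random walk on its state space. -/
def walkKernel [IsProbabilityMeasure ρ] : Kernel (stateSpace ρ) (stateSpace ρ) where
  toFun := fun x => (stepLaw ρ).map fun y => x + y
  measurable' := by
    refine Measure.measurable_of_measurable_coe _ fun s hs => ?_
    have h : Measurable fun p : stateSpace ρ × stateSpace ρ => p.1 + p.2 := measurable_add
    have h2 := measurable_measure_prodMk_left (ν := stepLaw ρ) (h hs)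
    have h3 : (fun x => (stepLaw ρ).map (fun y => x + y) s) =
        fun x => stepLaw ρ (Prod.mk x ⁻¹' ((fun p => p.1 + p.2) ⁻¹' s)) := by
      funext x
      rw [Measure.map_apply (measurable_const_add x) hs]
      rfl
    rw [h3]
    exact h2

instance [IsProbabilityMeasure ρ] : IsMarkovKernel (walkKernel ρ) :=
  ⟨fun x => Measure.isProbabilityMeasure_map (measurable_const_add x).aemeasurable⟩

/-- Topological recurrence: started at `0`, the walk visits every neighbourhood of `0`
infinitely often almost surely. -/
def IsTopologicallyRecurrent [IsProbabilityMeasure ρ] : Prop :=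
  ∀ G : Set (stateSpace ρ), IsOpen G → 0 ∈ G →
    ∀ᵐ ω ∂(chainLaw (walkKernel ρ) 0), ∃ᶠ n in Filter.atTop, ω n ∈ G

end RandomWalk

end EntranceExit

end

/-! Let P be the kernel of the walk. Split it as P = Q + C, where C keeps exactly the steps from Aᶜ
to A, and let G = ∑ Qⁿ be the Green kernel of Q. Decomposing over the time of the first crossing,
the first entrance position from x has law (GC)(x, ·), and the first exit position has law G(x, dy)
C(y, X). Both chains are thus written in terms of G and C.

Invariance, recurrence and ergodicity rest on one property of the Haar measure λ, `IsLiouville`: λ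
is P-invariant, bounded excessive functions are λ-a.e. constant, and excessive measures below λ are
multiples of λ. It has three consequences. From a.e. point a crossing happens almost surely
(`IsLiouville.ae_crossProb_eq_one`). The measure is recovered from its crossings, λ = (λC)G
(`IsLiouville.bind_cross_bind_green`), so (λC)GC = λC, which is invariance for the entrance chain;
the exit chain is similar. Finally, if f is bounded and excessive for the entrance kernel K, then Kf
= GCf extends to a P-excessive function on the whole group, hence is a.e. constant; again the exit
chain is similar. Constancy of Kf for all such f yields a zero-one law for shift-invariant events,
and from it ergodicity and recurrence (`ergodic_of_excessiveConst`, `recurrent_of_excessiveConst`).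

The Liouville property of the walk comes from the infinite Green measure of neighbourhoods of the
starting point. A bounded continuous excessive g must be harmonic, and so must c² - g², so g has
zero variance along a step; its periods then form a closed subgroup carrying the step law, hence
everything. Applied to x ↦ ∫ φ(x + y) m(dy), this makes each excessive m finite on compacts
translation invariant, hence a multiple of λ. Excessive functions F are handled by duality: Fλ is an
excessive measure of the reversed walk.

For uniqueness, an entrance-invariant η lifts to the P-invariant measure m = ηG with mC = η. The
only obstacle is that m might not be locally finite. As λ(∂A) = 0, some point interior to Aᶜ can
jump into the interior of A, so local finiteness of η bounds m on a nonempty open set, and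
irreducibility spreads the bound (`IsRecurrentStep.eq_smul_of_crossing`). Then m = cλ and η = cλC.
-/

noncomputable section

namespace EntranceExit

set_option linter.unusedSectionVars false

/-! ### Path measures and conditioning on the first step -/

section PathSpace

variable {E : Type*} [MeasurableSpace E]

/-- Two finite measures on path space which agree on all cylinders are equal. -/
theorem ext_of_cylinders {μ ν : Measure (ℕ → E)} [IsFiniteMeasure μ]
    (h : ∀ (n : ℕ) (B : ℕ → Set E), (∀ i, MeasurableSet (B i)) →
      μ {ω | ∀ i ≤ n, ω i ∈ B i} = ν {ω | ∀ i ≤ n, ω i ∈ B i}) : μ = ν := by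
  classical
  refine ext_of_generate_finite _ generateFrom_squareCylinders.symm
    (isPiSystem_squareCylinders (fun _ => MeasurableSpace.isPiSystem_measurableSet)
      fun _ => MeasurableSet.univ)
    ?_ ?_
  · rintro S ⟨s, t, ht, rfl⟩
    have ht' : ∀ i, MeasurableSet (t i) := fun i => ht i (mem_univ i)
    have key : (s : Set ℕ).pi t =
        {ω | ∀ i ≤ s.sup id, ω i ∈ (if i ∈ s then t i else univ : Set E)} := by
      ext ω
      simp only [mem_pi, Finset.mem_coe, mem_ofPred_eq]
      constructor
      · intro hω i _
        split_ifs with hi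
        · exact hω i hi
        · trivial
      · intro hω i hi
        have := hω i (Finset.le_sup (f := id) hi)
        rwa [if_pos hi] at this
    rw [key]
    refine h _ _ fun i => ?_
    split_ifs
    · exact ht' i
    · exact MeasurableSet.univ
  · simpa using h 0 (fun _ => univ) fun _ => MeasurableSet.univ

/-- Prepend a state to a path. -/
def consPath (x : E) (ω : ℕ → E) : ℕ → E := fun n => Nat.casesOn n x ω

@[simp] theorem consPath_zero (x : E) (ω : ℕ → E) : consPath x ω 0 = x := rfl

@[simp] theorem consPath_succ (x : E) (ω : ℕ → E) (n : ℕ) : consPath x ω (n + 1) = ω n := rfl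

theorem measurable_consPath (x : E) : Measurable (consPath x) := by
  refine measurable_pi_iff.2 fun n => ?_
  cases n with
  | zero => exact measurable_const
  | succ n => exact measurable_pi_apply n

theorem measurable_shift : Measurable (shift : (ℕ → E) → ℕ → E) :=
  measurable_pi_iff.2 fun n => measurable_pi_apply (n + 1)

variable (P : Kernel E E) [IsMarkovKernel P]

/-- The one-step transition kernels of a chain as functions of the whole past. -/
abbrev pastKernel (n : ℕ) : Kernel (Π _ : Finset.Iic n, E) E :=
  P.comap (fun h : (Π _ : Finset.Iic n, E) => h ⟨n, Finset.mem_Iic.2 le_rfl⟩)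
    (measurable_pi_apply _)

/-- Conditioning a chain on its past up to time `n`. -/
theorem lintegral_chainLaw_mul_succ (x : E) (n : ℕ) {g : (Π _ : Finset.Iic n, E) → ℝ≥0∞}
    (hg : Measurable g) {f : E → ℝ≥0∞} (hf : Measurable f) :
    ∫⁻ ω, g (fun i => ω i) * f (ω (n + 1)) ∂(chainLaw P x) =
      ∫⁻ ω, g (fun i => ω i) * ∫⁻ y, f y ∂(P (ω n)) ∂(chainLaw P x) := by
  have hm : ∀ n : ℕ, Measurable fun ω : ℕ → E => (fun i : Finset.Iic n => ω i) := fun n =>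
    measurable_pi_iff.2 fun i => measurable_pi_apply _
  set κ := pastKernel P
  -- The path is generated in two stages: the states up to time `n`, then the continuation given
  -- them. In the second stage the past is deterministic (`h4`), so `g` factors out.
  have h1 : chainLaw P x = (Kernel.partialTraj (X := fun _ => E) κ 0 n fun _ => x).bind
      (Kernel.traj (X := fun _ => E) κ n) := by
    change Kernel.traj (X := fun _ => E) κ 0 (fun _ => x) = _
    rw [← Kernel.traj_comp_partialTraj (X := fun _ => E) (κ := κ) (Nat.zero_le n),
      Kernel.comp_apply]
  have h2 : (chainLaw P x).map (fun ω (i : Finset.Iic n) => ω i) =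
      Kernel.partialTraj (X := fun _ => E) κ 0 n fun _ => x :=
    Kernel.traj_map_frestrictLe_apply (X := fun _ => E) (κ := κ) 0 n _
  have hP : Measurable fun u : (Π _ : Finset.Iic n, E) =>
      g u * ∫⁻ y, f y ∂(P (u ⟨n, Finset.mem_Iic.2 le_rfl⟩)) :=
    hg.mul (hf.lintegral_kernel.comp (measurable_pi_apply _))
  have h3 : ∀ u : (Π _ : Finset.Iic n, E),
      ∫⁻ ω, g (fun i => ω i) * f (ω (n + 1)) ∂(Kernel.traj (X := fun _ => E) κ n u) =
      g u * ∫⁻ y, f y ∂(P (u ⟨n, Finset.mem_Iic.2 le_rfl⟩)) := by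
    intro u
    have h4 : (Kernel.traj (X := fun _ => E) κ n u).map (fun ω (i : Finset.Iic n) => ω i) =
        Measure.dirac u := by
      refine (Kernel.traj_map_frestrictLe_apply (X := fun _ => E) (κ := κ) n n u).trans ?_
      rw [Kernel.partialTraj_self, Kernel.id_apply]
    have h5 : (Kernel.traj (X := fun _ => E) κ n u).map (fun ω => ω (n + 1)) = κ n u := by
      have := Kernel.map_traj_succ_self (X := fun _ => E) (κ := κ) (a := n)
      rw [← this, Kernel.map_apply _ (measurable_pi_apply _)]
    have h6 : ∀ᵐ ω ∂(Kernel.traj (X := fun _ => E) κ n u),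
        g (fun i => ω i) = g u := by
      have h7 : ∀ᵐ v ∂((Kernel.traj (X := fun _ => E) κ n u).map
          (fun ω (i : Finset.Iic n) => ω i)), g v = g u := by
        rw [h4]
        exact (ae_dirac_iff (measurableSet_eq_fun hg measurable_const)).2 rfl
      exact ae_of_ae_map (hm n).aemeasurable h7
    rw [lintegral_congr_ae (h6.mono fun ω hω => congrArg (· * f (ω (n + 1))) hω :
      (fun ω : ℕ → E => g (fun i => ω i) * f (ω (n + 1))) =ᵐ[_] fun ω => g u * f (ω (n + 1))),
      lintegral_const_mul (f := fun ω : ℕ → E => f (ω (n + 1))) _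
        (hf.comp (measurable_pi_apply (n + 1))),
      ← lintegral_map (f := f) hf (measurable_pi_apply (n + 1)), h5]
    rfl
  have h8 : ∫⁻ ω, g (fun i => ω i) * ∫⁻ y, f y ∂(P (ω n)) ∂(chainLaw P x) =
      ∫⁻ u, g u * ∫⁻ y, f y ∂(P (u ⟨n, Finset.mem_Iic.2 le_rfl⟩))
        ∂((chainLaw P x).map (fun ω (i : Finset.Iic n) => ω i)) := by
    rw [lintegral_map hP (hm n)]
  rw [h8, h2, h1, Measure.lintegral_bind
    (f := fun ω : ℕ → E => g (fun i : Finset.Iic n => ω i) * f (ω (n + 1)))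
    (Kernel.measurable _).aemeasurable
    (((hg.comp (hm n)).mul (hf.comp (measurable_pi_apply _))).aemeasurable)]
  exact lintegral_congr h3

/-- This says that the path starts at `x`, phrased through test functions because singletons of `E`
need not be measurable. -/
theorem ae_chainLaw_zero (x : E) {f : E → ℝ≥0∞} (hf : Measurable f) :
    ∀ᵐ ω ∂(chainLaw P x), f (ω 0) = f x := by
  have h2 : (chainLaw P x).map (fun ω (i : Finset.Iic 0) => ω i) =
      Measure.dirac fun _ => x := by
    refine (Kernel.traj_map_frestrictLe_apply (X := fun _ => E) (κ := pastKernel P) 0 0 _).trans ?_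
    rw [Kernel.partialTraj_self, Kernel.id_apply]
  have hm : Measurable fun ω : ℕ → E => (fun i : Finset.Iic 0 => ω i) :=
    measurable_pi_iff.2 fun i => measurable_pi_apply _
  have h7 : ∀ᵐ v ∂((chainLaw P x).map (fun ω (i : Finset.Iic 0) => ω i)),
      f (v ⟨0, Finset.mem_Iic.2 le_rfl⟩) = f x := by
    rw [h2]
    exact (ae_dirac_iff (measurableSet_eq_fun (hf.comp (measurable_pi_apply _))
      measurable_const)).2 rfl
  exact ae_of_ae_map hm.aemeasurable h7

/-- The expectation of a product of functions of the first states of a chain, computed by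
conditioning on the first step. -/
def prodExp (P : Kernel E E) : ℕ → (ℕ → E → ℝ≥0∞) → E → ℝ≥0∞
  | 0, f, x => f 0 x
  | n + 1, f, x => f 0 x * ∫⁻ y, prodExp P n (fun i => f (i + 1)) y ∂(P x)

theorem prodExp_succ (P : Kernel E E) (n : ℕ) (f : ℕ → E → ℝ≥0∞) (x : E) :
    prodExp P (n + 1) f x = f 0 x * ∫⁻ y, prodExp P n (fun i => f (i + 1)) y ∂(P x) := rfl

/-- The recursion of `prodExp` peels off the first step, whereas the Ionescu-Tulcea construction
peels off the last one; this identity lets the two meet. -/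
theorem prodExp_succ_last (P : Kernel E E) (n : ℕ) (f : ℕ → E → ℝ≥0∞) (x : E) :
    prodExp P (n + 1) f x =
      prodExp P n (Function.update f n fun y => f n y * ∫⁻ z, f (n + 1) z ∂(P y)) x := by
  induction n generalizing f x with
  | zero => simp [prodExp]
  | succ n ih =>
    rw [prodExp_succ, prodExp_succ P n]
    simp_rw [ih]
    have : Function.update f (n + 1) (fun y => f (n + 1) y * ∫⁻ z, f (n + 1 + 1) z ∂(P y)) 0 =
        f 0 := Function.update_of_ne (by omega) _ _
    rw [this]
    congr 2
    funext y
    congr 1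
    funext i
    by_cases hi : i = n
    · subst hi; simp
    · rw [Function.update_of_ne hi, Function.update_of_ne (by omega)]

theorem lintegral_chainLaw_prod (x : E) (n : ℕ) (f : ℕ → E → ℝ≥0∞) (hf : ∀ i, Measurable (f i)) :
    ∫⁻ ω, ∏ i ∈ Finset.range (n + 1), f i (ω i) ∂(chainLaw P x) = prodExp P n f x := by
  induction n generalizing f with
  | zero =>
    simp only [zero_add, Finset.prod_range_one, prodExp]
    rw [lintegral_congr_ae (ae_chainLaw_zero P x (hf 0))]
    simp
  | succ n ih =>
    have hPf : Measurable fun y => ∫⁻ z, f (n + 1) z ∂(P y) := (hf (n + 1)).lintegral_kernel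
    rw [prodExp_succ_last, ← ih]
    · simp_rw [Finset.prod_range_succ _ (n + 1)]
      have hg : Measurable fun u : (Π _ : Finset.Iic n, E) =>
          ∏ i : Finset.Iic n, f i (u i) := by
        refine Finset.measurable_prod _ fun i _ => (hf i).comp (measurable_pi_apply i)
      have hconv : ∀ ω : ℕ → E, ∏ i ∈ Finset.range (n + 1), f i (ω i) =
          ∏ i : Finset.Iic n, f i (ω i) := by
        intro ω
        rw [Finset.prod_coe_sort (Finset.Iic n) fun i => f i (ω i)]
        congr 1
        ext i; simp
      have := lintegral_chainLaw_mul_succ P x n hg (hf (n + 1))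
      simp_rw [hconv]
      rw [this]
      simp_rw [← hconv]
      refine lintegral_congr fun ω => ?_
      rw [Finset.prod_range_succ, Finset.prod_range_succ, Function.update_self, mul_assoc]
      congr 1
      refine Finset.prod_congr rfl fun i hi => ?_
      rw [Function.update_of_ne (Finset.mem_range.1 hi).ne]
    · intro i
      by_cases hi : i = n
      · subst hi; rw [Function.update_self]; exact (hf i).mul hPf
      · rw [Function.update_of_ne hi]; exact hf i

/-- This is the Markov property at time 1. Both sides give a cylinder the same iterated integral,
and cylinders determine a finite measure on path space. -/
theorem chainLaw_eq_bind (x : E) :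
    chainLaw P x = ((P x).bind (chainLaw P)).map (consPath x) := by
  refine ext_of_cylinders fun n B hB => ?_
  have hf : ∀ i, Measurable ((B i).indicator (1 : E → ℝ≥0∞)) := fun i =>
    measurable_one.indicator (hB i)
  have hset : ∀ n (B : ℕ → Set E), (∀ i, MeasurableSet (B i)) →
      MeasurableSet {ω : ℕ → E | ∀ i ≤ n, ω i ∈ B i} := by
    intro n B hB
    have : {ω : ℕ → E | ∀ i ≤ n, ω i ∈ B i} = ⋂ i, ⋂ (_ : i ≤ n), (fun ω => ω i) ⁻¹' B i := by
      ext; simp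
    rw [this]
    exact MeasurableSet.iInter fun i => MeasurableSet.iInter fun _ => measurable_pi_apply i (hB i)
  have hind : ∀ n (B : ℕ → Set E) (ω : ℕ → E),
      ∏ i ∈ Finset.range (n + 1), (B i).indicator (1 : E → ℝ≥0∞) (ω i) =
      {ω : ℕ → E | ∀ i ≤ n, ω i ∈ B i}.indicator 1 ω := by
    intro n B ω
    by_cases h : ω ∈ {ω : ℕ → E | ∀ i ≤ n, ω i ∈ B i}
    · rw [indicator_of_mem h]
      exact Finset.prod_eq_one fun i hi => indicator_of_mem
        (h i (Nat.lt_succ_iff.1 (Finset.mem_range.1 hi))) _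
    · rw [indicator_of_notMem h]
      simp only [mem_ofPred_eq, not_forall] at h
      obtain ⟨i, hi, hi'⟩ := h
      exact Finset.prod_eq_zero (Finset.mem_range.2 (Nat.lt_succ_iff.2 hi))
        (indicator_of_notMem hi' _)
  have hlaw : ∀ n (B : ℕ → Set E) (hB : ∀ i, MeasurableSet (B i)) (x : E),
      chainLaw P x {ω | ∀ i ≤ n, ω i ∈ B i} =
        prodExp P n (fun i => (B i).indicator 1) x := by
    intro n B hB x
    rw [← lintegral_chainLaw_prod P x n _ fun i => measurable_one.indicator (hB i)]
    simp_rw [hind]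
    rw [lintegral_indicator_one (hset n B hB)]
  rw [hlaw n B hB, Measure.map_apply (measurable_consPath x) (hset n B hB),
    Measure.bind_apply (measurable_consPath x (hset n B hB)) (Kernel.measurable _).aemeasurable]
  by_cases hx : x ∈ B 0
  · cases n with
    | zero => simp [prodExp, hx]
    | succ n =>
      have : consPath x ⁻¹' {ω | ∀ i ≤ n + 1, ω i ∈ B i} = {ω | ∀ i ≤ n, ω i ∈ B (i + 1)} := by
        ext ω
        constructor
        · intro h i hi
          exact h (i + 1) (by omega)
        · rintro h (_ | i) hi
          · exact hx
          · exact h i (by omega)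
      rw [this, prodExp_succ, indicator_of_mem hx, Pi.one_apply, one_mul]
      exact lintegral_congr fun y => (hlaw n (fun i => B (i + 1)) (fun i => hB _) y).symm
  · have : consPath x ⁻¹' {ω | ∀ i ≤ n, ω i ∈ B i} = ∅ := by
      ext ω
      simp only [mem_preimage, mem_ofPred_eq, mem_empty_iff_false, iff_false]
      exact fun h => hx (h 0 (Nat.zero_le n))
    rw [this]
    cases n <;> simp only [prodExp, indicator_of_notMem hx, zero_mul, measure_empty,
      lintegral_zero]

/-- Conditioning a chain on its first step. -/
theorem lintegral_chainLaw (x : E) {F : (ℕ → E) → ℝ≥0∞} (hF : Measurable F) :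
    ∫⁻ ω, F ω ∂(chainLaw P x) =
      ∫⁻ y, ∫⁻ ω, F (consPath x ω) ∂(chainLaw P y) ∂(P x) := by
  conv_lhs => rw [chainLaw_eq_bind]
  rw [lintegral_map hF (measurable_consPath x),
    Measure.lintegral_bind (f := fun ω => F (consPath x ω)) (Kernel.measurable _).aemeasurable
      (hF.comp (measurable_consPath x)).aemeasurable]

theorem chainLaw_apply (x : E) {s : Set (ℕ → E)} (hs : MeasurableSet s) :
    chainLaw P x s = ∫⁻ y, chainLaw P y (consPath x ⁻¹' s) ∂(P x) := by
  conv_lhs => rw [chainLaw_eq_bind]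
  rw [Measure.map_apply (measurable_consPath x) hs,
    Measure.bind_apply (measurable_consPath x hs) (Kernel.measurable _).aemeasurable]

end PathSpace

/-! ### Recurrence and ergodicity from constancy of excessive functions -/

section ErgodicCriterion

variable {E : Type*} [MeasurableSpace E] {P : Kernel E E} [IsMarkovKernel P] {π : Measure E}

theorem lintegral_lintegral_of_bind_eq (hπ : π.bind P = π) {f : E → ℝ≥0∞} (hf : Measurable f) :
    ∫⁻ x, ∫⁻ y, f y ∂(P x) ∂π = ∫⁻ x, f x ∂π := by
  conv_rhs => rw [← hπ]
  rw [Measure.lintegral_bind P.measurable.aemeasurable hf.aemeasurable]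

theorem ae_ae_of_bind_eq (hπ : π.bind P = π) {p : E → Prop} (hp : ∀ᵐ x ∂π, p x) :
    ∀ᵐ x ∂π, ∀ᵐ y ∂(P x), p y := by
  rw [← hπ] at hp
  exact Measure.ae_ae_of_ae_comp hp

/-- A property that holds almost everywhere for an invariant measure holds on a conull set that
the chain does not leave. -/
theorem exists_absorbing_set (hπ : π.bind P = π) {p : E → Prop} (hp : ∀ᵐ x ∂π, p x) :
    ∃ G : Set E, (∀ᵐ x ∂π, x ∈ G) ∧ ∀ x ∈ G, p x ∧ ∀ᵐ y ∂(P x), y ∈ G := by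
  -- `q n x` says that, almost surely at each of `n` successive steps from `x`, one ends at a state
  -- satisfying `p`. The set where all `q n` hold is absorbing, and its measurability is never
  -- needed.
  let q : ℕ → E → Prop := fun n => Nat.rec p (fun _ r x => ∀ᵐ y ∂(P x), r y) n
  have hq : ∀ n, ∀ᵐ x ∂π, q n x := by
    intro n
    induction n with
    | zero => exact hp
    | succ n ih => exact ae_ae_of_bind_eq hπ ih
  exact ⟨{x | ∀ n, q n x}, ae_all_iff.2 hq, fun x hx => ⟨hx 0, ae_all_iff.2 fun n => hx (n + 1)⟩⟩

theorem measurePreserving_shift (hπ : π.bind P = π) :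
    MeasurePreserving shift (π.bind (chainLaw P)) (π.bind (chainLaw P)) := by
  refine ⟨measurable_shift, ?_⟩
  ext s hs
  rw [Measure.map_apply measurable_shift hs,
    Measure.bind_apply (measurable_shift hs) (Kernel.measurable _).aemeasurable,
    Measure.bind_apply hs (Kernel.measurable _).aemeasurable]
  simp_rw [chainLaw_apply P _ (measurable_shift hs)]
  exact lintegral_lintegral_of_bind_eq hπ (Kernel.measurable_coe _ hs)

variable (P π) in
/-- Bounded excessive functions are constant after one step. -/
def ExcessiveConst : Prop :=
  ∀ f : E → ℝ≥0∞, Measurable f → (∀ x, f x ≤ 1) → (∀ x, ∫⁻ y, f y ∂(P x) ≤ f x) →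
    ∃ c : ℝ≥0∞, ∀ᵐ x ∂π, ∫⁻ y, f y ∂(P x) = c

theorem measurableSet_cylinder {B : ℕ → Set E} (hB : ∀ i, MeasurableSet (B i)) (n : ℕ) :
    MeasurableSet {ω : ℕ → E | ∀ i < n, ω i ∈ B i} := by
  have : {ω : ℕ → E | ∀ i < n, ω i ∈ B i} = ⋂ i, ⋂ (_ : i < n), (fun ω => ω i) ⁻¹' B i := by
    ext; simp
  rw [this]
  exact MeasurableSet.iInter fun i => MeasurableSet.iInter fun _ => measurable_pi_apply i (hB i)

/-- If the probability of a shift-invariant event does not depend on the starting point, the event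
is independent of the past. -/
theorem chainLaw_inter_cylinder {s : Set (ℕ → E)} (hs : MeasurableSet s)
    (hinv : shift ⁻¹' s = s) {c : ℝ≥0∞} {G : Set E}
    (hG : ∀ x ∈ G, chainLaw P x s = c ∧ ∀ᵐ y ∂(P x), y ∈ G) (n : ℕ) (B : ℕ → Set E)
    (hB : ∀ i, MeasurableSet (B i)) (x : E) (hx : x ∈ G) :
    chainLaw P x ({ω | ∀ i < n, ω i ∈ B i} ∩ s) =
      c * chainLaw P x {ω | ∀ i < n, ω i ∈ B i} := by
  have hcons : ∀ x, consPath x ⁻¹' s = s := fun x => by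
    conv_lhs => rw [← hinv]
    rfl
  induction n generalizing B x with
  | zero => simp [(hG x hx).1]
  | succ n ih =>
    have hm := measurableSet_cylinder hB (n + 1)
    have hm' := measurableSet_cylinder (fun i => hB (i + 1)) n
    rw [chainLaw_apply P x (hm.inter hs), chainLaw_apply P x hm]
    simp_rw [preimage_inter, hcons]
    by_cases h0 : x ∈ B 0
    · have : consPath x ⁻¹' {ω | ∀ i < n + 1, ω i ∈ B i} = {ω | ∀ i < n, ω i ∈ B (i + 1)} := by
        ext ω
        constructor
        · intro h i hi
          exact h (i + 1) (by omega)
        · rintro h (_ | i) hi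
          · exact h0
          · exact h i (by omega)
      rw [this, ← lintegral_const_mul _ (Kernel.measurable_coe _ hm')]
      refine lintegral_congr_ae ?_
      filter_upwards [(hG x hx).2] with y hy
      exact ih (fun i => B (i + 1)) (fun i => hB _) y hy
    · have : consPath x ⁻¹' {ω | ∀ i < n + 1, ω i ∈ B i} = ∅ := by
        ext ω
        simp only [mem_preimage, mem_ofPred_eq, mem_empty_iff_false, iff_false]
        exact fun h => h0 (h 0 (Nat.succ_pos n))
      rw [this]
      simp only [empty_inter, measure_empty, lintegral_zero, mul_zero]

/-- For an invariant event, x ↦ ℙ_x(s) is harmonic, hence a.e. a constant `c`. Started in an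
absorbing set where it equals `c`, the event is independent of every cylinder, therefore of itself,
and c = c². -/
theorem zero_one_of_excessiveConst (hπ : π.bind P = π) (h : ExcessiveConst P π)
    {s : Set (ℕ → E)} (hs : MeasurableSet s) (hinv : shift ⁻¹' s = s) :
    (∀ᵐ x ∂π, chainLaw P x s = 0) ∨ (∀ᵐ x ∂π, chainLaw P x s = 1) := by
  have hharm : ∀ x, ∫⁻ y, chainLaw P y s ∂(P x) = chainLaw P x s := by
    intro x
    conv_rhs => rw [← hinv, chainLaw_apply P x (measurable_shift hs)]
    rfl
  obtain ⟨c, hc⟩ := h (fun x => chainLaw P x s) (Kernel.measurable_coe _ hs)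
    (fun x => prob_le_one) fun x => (hharm x).le
  simp_rw [hharm] at hc
  obtain ⟨G, hGπ, hG⟩ := exists_absorbing_set hπ hc
  rcases G.eq_empty_or_nonempty with rfl | ⟨x, hx⟩
  · exact Or.inl (hGπ.mono fun x hx => hx.elim)
  · have heq : (chainLaw P x).restrict s = c • chainLaw P x := by
      refine ext_of_cylinders fun n B hB => ?_
      have := chainLaw_inter_cylinder hs hinv hG (n + 1) B hB x hx
      simp_rw [Nat.lt_succ_iff] at this
      have hm := measurableSet_cylinder hB (n + 1)
      simp_rw [Nat.lt_succ_iff] at hm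
      rw [Measure.restrict_apply hm, this]
      rfl
    have hcc : c = c * c := by
      have := congrArg (fun m => m s) heq
      simpa [(hG x hx).1] using this
    have hc1 : c ≤ 1 := by
      rw [← (hG x hx).1]; exact prob_le_one
    by_cases hc0 : c = 0
    · exact Or.inl (hc0 ▸ hc)
    · right
      have : c = 1 := by
        have h1 : c * 1 = c * c := by rw [mul_one]; exact hcc
        exact ((ENNReal.mul_right_inj hc0 (hc1.trans_lt ENNReal.one_lt_top).ne).1 h1).symm
      exact this ▸ hc

theorem ergodic_of_excessiveConst (hπ : π.bind P = π) (h : ExcessiveConst P π) :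
    Ergodic shift (π.bind (chainLaw P)) := by
  refine { toMeasurePreserving := measurePreserving_shift hπ, aeconst_set := ?_ }
  intro s hs hinv
  rw [Filter.eventuallyConst_set']
  rcases zero_one_of_excessiveConst hπ h hs hinv with h0 | h1
  · left
    rw [ae_eq_empty, Measure.bind_apply hs (Kernel.measurable _).aemeasurable,
      lintegral_eq_zero_iff (Kernel.measurable_coe _ hs)]
    exact h0
  · right
    rw [ae_eq_univ, Measure.bind_apply hs.compl (Kernel.measurable _).aemeasurable,
      lintegral_eq_zero_iff (Kernel.measurable_coe _ hs.compl)]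
    exact h1.mono fun x hx => (prob_compl_eq_zero_iff hs).2 hx

theorem measurableSet_exists_ge {B : Set E} (hB : MeasurableSet B) (n : ℕ) :
    MeasurableSet {ω : ℕ → E | ∃ k, n ≤ k ∧ ω k ∈ B} := by
  have : {ω : ℕ → E | ∃ k, n ≤ k ∧ ω k ∈ B} = ⋃ k, ⋃ (_ : n ≤ k), (fun ω => ω k) ⁻¹' B := by
    ext; simp
  rw [this]
  exact MeasurableSet.iUnion fun i => MeasurableSet.iUnion fun _ => measurable_pi_apply i hB

/-- The probability of visiting `B` at a time at least `n` is a.e. the same constant for every `n ≥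
1`, so it is also the probability of infinitely many visits, which the zero-one law forces to be 0
or 1. -/
theorem recurrent_of_excessiveConst (hπ : π.bind P = π) (h : ExcessiveConst P π)
    {B : Set E} (hB : MeasurableSet B) :
    ∀ᵐ x ∂π, x ∈ B → ∀ᵐ ω ∂(chainLaw P x), ∃ n : ℕ, 1 ≤ n ∧ ω n ∈ B := by
  set V : ℕ → Set (ℕ → E) := fun n => {ω | ∃ k, n ≤ k ∧ ω k ∈ B} with hV
  have hVm : ∀ n, MeasurableSet (V n) := measurableSet_exists_ge hB
  have hanti : Antitone V := fun m n hmn ω ⟨k, hk, hk'⟩ => ⟨k, hmn.trans hk, hk'⟩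
  have hstep : ∀ n x, ∫⁻ y, chainLaw P y (V n) ∂(P x) = chainLaw P x (V (n + 1)) := by
    intro n x
    rw [chainLaw_apply P x (hVm _)]
    have : consPath x ⁻¹' V (n + 1) = V n := by
      ext ω
      constructor
      · rintro ⟨_ | k, hk, hk'⟩
        · omega
        · exact ⟨k, by omega, hk'⟩
      · rintro ⟨k, hk, hk'⟩
        exact ⟨k + 1, by omega, hk'⟩
    rw [this]
  obtain ⟨c, hc⟩ := h (fun x => chainLaw P x (V 0)) (Kernel.measurable_coe _ (hVm 0))
    (fun x => prob_le_one) fun x => by rw [hstep]; exact measure_mono (hanti (Nat.zero_le _))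
  simp_rw [hstep] at hc
  have hcn : ∀ n, ∀ᵐ x ∂π, chainLaw P x (V (n + 1)) = c := by
    intro n
    induction n with
    | zero => exact hc
    | succ n ih =>
      filter_upwards [ae_ae_of_bind_eq hπ ih] with x hx
      rw [← hstep, lintegral_congr_ae hx]
      simp
  have hlim : ∀ᵐ x ∂π, chainLaw P x (⋂ n, V n) = c := by
    filter_upwards [ae_all_iff.2 hcn] with x hx
    have h1 := tendsto_measure_iInter_atTop (μ := chainLaw P x)
      (fun n => (hVm n).nullMeasurableSet) hanti ⟨0, measure_ne_top _ _⟩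
    have h2 := (Filter.tendsto_add_atTop_iff_nat 1).2 h1
    simp only [Function.comp_apply, hx] at h2
    exact tendsto_nhds_unique h2 tendsto_const_nhds
  have hinv : shift ⁻¹' (⋂ n, V n) = ⋂ n, V n := by
    ext ω
    simp only [mem_preimage, mem_iInter]
    constructor
    · intro hω n
      obtain ⟨k, hk, hk'⟩ := hω n
      exact ⟨k + 1, by omega, hk'⟩
    · intro hω n
      obtain ⟨_ | k, hk, hk'⟩ := hω (n + 1)
      · omega
      · exact ⟨k, by omega, hk'⟩
  rcases zero_one_of_excessiveConst hπ h (MeasurableSet.iInter hVm) hinv with h0 | h1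
  -- If the constant is 0, even the one-step probability of `B` vanishes a.e., and invariance gives
  -- `π B = 0`: there are no starting points to consider.
  · have hB0 : π B = 0 := by
      rw [← hπ, Measure.bind_apply hB P.measurable.aemeasurable,
        lintegral_eq_zero_iff (P.measurable_coe hB)]
      filter_upwards [hc, hlim, h0] with x hx1 hx2 hx3
      have hsup : P x B ≤ chainLaw P x (V 1) := by
        rw [← hstep 0, ← lintegral_indicator_one hB]
        refine lintegral_mono fun y => ?_
        by_cases hy : y ∈ B
        · rw [indicator_of_mem hy, Pi.one_apply, ← measure_univ (μ := chainLaw P y)]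
          refine measure_mono_ae ?_
          filter_upwards [ae_chainLaw_zero P y
            (measurable_one.indicator hB : Measurable (B.indicator (1 : E → ℝ≥0∞)))] with ω hω _
          refine ⟨0, le_rfl, ?_⟩
          by_contra hcon
          rw [indicator_of_mem hy, indicator_of_notMem hcon] at hω
          exact zero_ne_one hω
        · rw [indicator_of_notMem hy]; exact zero_le
      have : c = 0 := hx2.symm.trans hx3
      exact le_antisymm (hsup.trans_eq (hx1.trans this)) zero_le
    filter_upwards [measure_eq_zero_iff_ae_notMem.1 hB0] with x hx hx'
    exact (hx hx').elim
  · filter_upwards [hc, hlim, h1] with x hx1 hx2 hx3 _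
    have : chainLaw P x (V 1) = 1 := by rw [hx1, ← hx2, hx3]
    exact (mem_ae_iff_prob_eq_one (hVm 1)).2 this

end ErgodicCriterion

/-! ### Green kernels and the equation μ = ζ + μQ -/

section Green

variable {X : Type*} [MeasurableSpace X]

/-- The Green kernel `∑ₙ Qⁿ`. -/
def greenKernel (Q : Kernel X X) : Kernel X X := Kernel.sum fun n : ℕ => Q ^ n

variable (Q : Kernel X X)

theorem lintegral_pow_zero (x : X) {f : X → ℝ≥0∞} (hf : Measurable f) :
    ∫⁻ y, f y ∂((Q ^ 0) x) = f x := by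
  rw [pow_zero]
  exact (congrArg (fun m => ∫⁻ y, f y ∂m) (Kernel.id_apply x)).trans (lintegral_dirac' x hf)

theorem lintegral_pow_succ (n : ℕ) (x : X) {f : X → ℝ≥0∞} (hf : Measurable f) :
    ∫⁻ y, f y ∂((Q ^ (n + 1)) x) = ∫⁻ y, ∫⁻ z, f z ∂((Q ^ n) y) ∂(Q x) := by
  rw [pow_succ]
  exact Kernel.lintegral_comp _ _ _ hf

theorem lintegral_pow_succ' (n : ℕ) (x : X) {f : X → ℝ≥0∞} (hf : Measurable f) :
    ∫⁻ y, f y ∂((Q ^ (n + 1)) x) = ∫⁻ y, ∫⁻ z, f z ∂(Q y) ∂((Q ^ n) x) := by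
  rw [pow_succ']
  exact Kernel.lintegral_comp _ _ _ hf

theorem lintegral_green (x : X) (f : X → ℝ≥0∞) :
    ∫⁻ y, f y ∂(greenKernel Q x) = ∑' n : ℕ, ∫⁻ y, f y ∂((Q ^ n) x) := by
  rw [greenKernel, Kernel.sum_apply, lintegral_sum_measure]

theorem lintegral_green_eq_add (x : X) {f : X → ℝ≥0∞} (hf : Measurable f) :
    ∫⁻ y, f y ∂(greenKernel Q x) = f x + ∫⁻ y, ∫⁻ z, f z ∂(greenKernel Q y) ∂(Q x) := by
  rw [lintegral_green, tsum_eq_zero_add' ENNReal.summable, lintegral_pow_zero Q x hf]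
  simp_rw [lintegral_green, lintegral_pow_succ Q _ x hf]
  rw [lintegral_tsum fun n => hf.lintegral_kernel.aemeasurable]

theorem lintegral_green_eq_add' (x : X) {f : X → ℝ≥0∞} (hf : Measurable f) :
    ∫⁻ y, f y ∂(greenKernel Q x) = f x + ∫⁻ y, ∫⁻ z, f z ∂(Q y) ∂(greenKernel Q x) := by
  rw [lintegral_green, tsum_eq_zero_add' ENNReal.summable, lintegral_pow_zero Q x hf,
    lintegral_green]
  simp_rw [lintegral_pow_succ' Q _ x hf]

theorem lintegral_bind_kernel (m : Measure X) (κ : Kernel X X) {f : X → ℝ≥0∞} (hf : Measurable f) :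
    ∫⁻ y, f y ∂(m.bind κ) = ∫⁻ x, ∫⁻ y, f y ∂(κ x) ∂m :=
  Measure.lintegral_bind κ.measurable.aemeasurable hf.aemeasurable

theorem bind_green_eq_add (ζ : Measure X) :
    ζ.bind (greenKernel Q) = ζ + (ζ.bind (greenKernel Q)).bind Q := by
  refine Measure.ext_of_lintegral _ fun f hf => ?_
  rw [lintegral_add_measure, lintegral_bind_kernel _ _ hf, lintegral_bind_kernel _ _ hf,
    lintegral_bind_kernel _ _ hf.lintegral_kernel]
  simp_rw [lintegral_green_eq_add' Q _ hf]
  rw [lintegral_add_left hf]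

/-- The Green kernel applied to `ζ` gives the minimal solution of `μ = ζ + μ Q`. -/
theorem bind_green_le {μ ζ : Measure X} (h : ζ + μ.bind Q = μ) : ζ.bind (greenKernel Q) ≤ μ := by
  refine Measure.le_iff.2 fun s hs => ?_
  have hind : Measurable (s.indicator (1 : X → ℝ≥0∞)) := measurable_one.indicator hs
  -- Iterating the equation `n` times leaves the remainder μQⁿ. Dropping this nonnegative term gives
  -- the bound, without any subtraction or finiteness.
  have key : ∀ n : ℕ, ∀ f : X → ℝ≥0∞, Measurable f →
      (∑ k ∈ Finset.range n, ∫⁻ x, ∫⁻ y, f y ∂((Q ^ k) x) ∂ζ) +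
        ∫⁻ x, ∫⁻ y, f y ∂((Q ^ n) x) ∂μ = ∫⁻ x, f x ∂μ := by
    intro n
    induction n with
    | zero =>
      intro f hf
      simp_rw [lintegral_pow_zero Q _ hf]
      simp
    | succ n ih =>
      intro f hf
      rw [Finset.sum_range_succ, add_assoc, ← ih f hf]
      congr 1
      conv_rhs => rw [← h, lintegral_add_measure, lintegral_bind_kernel _ _ hf.lintegral_kernel]
      simp_rw [lintegral_pow_succ Q _ _ hf]
  rw [← lintegral_indicator_one hs, ← lintegral_indicator_one hs, lintegral_bind_kernel _ _ hind]
  simp_rw [lintegral_green]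
  rw [lintegral_tsum fun n => hind.lintegral_kernel.aemeasurable]
  refine ENNReal.tsum_le_of_sum_range_le fun n => ?_
  rw [← key n _ hind]
  exact le_self_add

end Green

/-! ### Splitting the kernel at crossings; entrance and exit laws via the Green kernel -/

section Crossing

variable {X : Type*} [MeasurableSpace X] (P : Kernel X X) [IsMarkovKernel P] {A : Set X}

open Classical in
/-- The steps of the chain which do not go from `Aᶜ` to `A`. -/
def stayKernel (hA : MeasurableSet A) : Kernel X X :=
  Kernel.piecewise hA P (P.restrict hA.compl)

open Classical in
/-- The steps of the chain which go from `Aᶜ` to `A`. -/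
def crossKernel (hA : MeasurableSet A) : Kernel X X :=
  Kernel.piecewise hA 0 (P.restrict hA)

variable (hA : MeasurableSet A)

open Classical in
theorem stayKernel_of_mem {x : X} (hx : x ∈ A) : stayKernel P hA x = P x := by
  rw [stayKernel, Kernel.piecewise_apply, if_pos hx]

open Classical in
theorem stayKernel_of_notMem {x : X} (hx : x ∉ A) : stayKernel P hA x = (P x).restrict Aᶜ := by
  rw [stayKernel, Kernel.piecewise_apply, if_neg hx, Kernel.restrict_apply]

open Classical in
theorem crossKernel_of_mem {x : X} (hx : x ∈ A) : crossKernel P hA x = 0 := by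
  rw [crossKernel, Kernel.piecewise_apply, if_pos hx]; rfl

open Classical in
theorem crossKernel_of_notMem {x : X} (hx : x ∉ A) : crossKernel P hA x = (P x).restrict A := by
  rw [crossKernel, Kernel.piecewise_apply, if_neg hx, Kernel.restrict_apply]

theorem stay_add_cross (x : X) : stayKernel P hA x + crossKernel P hA x = P x := by
  by_cases hx : x ∈ A
  · rw [stayKernel_of_mem P hA hx, crossKernel_of_mem P hA hx, add_zero]
  · rw [stayKernel_of_notMem P hA hx, crossKernel_of_notMem P hA hx, add_comm,
      Measure.restrict_add_restrict_compl hA]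

theorem lintegral_stay_add_cross (x : X) (f : X → ℝ≥0∞) :
    ∫⁻ y, f y ∂(stayKernel P hA x) + ∫⁻ y, f y ∂(crossKernel P hA x) = ∫⁻ y, f y ∂(P x) := by
  rw [← lintegral_add_measure, stay_add_cross]

theorem bind_stay_add_cross (m : Measure X) :
    m.bind (stayKernel P hA) + m.bind (crossKernel P hA) = m.bind P := by
  refine Measure.ext_of_lintegral _ fun f hf => ?_
  rw [lintegral_add_measure, lintegral_bind_kernel _ _ hf, lintegral_bind_kernel _ _ hf,
    lintegral_bind_kernel _ _ hf, ← lintegral_add_left hf.lintegral_kernel]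
  simp_rw [lintegral_stay_add_cross]

theorem crossKernel_apply_compl (x : X) : crossKernel P hA x Aᶜ = 0 := by
  by_cases hx : x ∈ A
  · simp [crossKernel_of_mem P hA hx]
  · rw [crossKernel_of_notMem P hA hx, Measure.restrict_apply hA.compl]; simp

theorem bind_crossKernel_compl (m : Measure X) : m.bind (crossKernel P hA) Aᶜ = 0 := by
  rw [Measure.bind_apply hA.compl (Kernel.measurable _).aemeasurable]
  simp [crossKernel_apply_compl]

theorem crossKernel_univ_of_notMem {x : X} (hx : x ∉ A) : crossKernel P hA x univ = P x A := by
  rw [crossKernel_of_notMem P hA hx, Measure.restrict_apply_univ]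

theorem crossKernel_univ_of_mem {x : X} (hx : x ∈ A) : crossKernel P hA x univ = 0 := by
  simp [crossKernel_of_mem P hA hx]

variable (A) in
/-- The paths whose first crossing from `Aᶜ` to `A` is between the times `k` and `k + 1`. -/
def firstCross (k : ℕ) : Set (ℕ → X) :=
  {ω | (ω k ∈ Aᶜ ∧ ω (k + 1) ∈ A) ∧ ∀ j < k, ¬ (ω j ∈ Aᶜ ∧ ω (j + 1) ∈ A)}

theorem measurableSet_firstCross (hA : MeasurableSet A) (k : ℕ) :
    MeasurableSet (firstCross A k) := by
  have : firstCross A k = {ω : ℕ → X | ω k ∈ Aᶜ ∧ ω (k + 1) ∈ A} ∩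
      ⋂ j, ⋂ (_ : j < k), {ω : ℕ → X | ω j ∈ Aᶜ ∧ ω (j + 1) ∈ A}ᶜ := by
    ext ω; simp [firstCross]
  rw [this]
  exact (measurableSet_cross hA k).inter (MeasurableSet.iInter fun j => MeasurableSet.iInter
    fun _ => (measurableSet_cross hA j).compl)

theorem ae_chainLaw_mem_iff (hA : MeasurableSet A) (x : X) :
    ∀ᵐ ω ∂(chainLaw P x), ω 0 ∈ A ↔ x ∈ A := by
  filter_upwards [ae_chainLaw_zero P x
    (measurable_one.indicator hA : Measurable (A.indicator (1 : X → ℝ≥0∞)))] with ω hω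
  by_cases h : ω 0 ∈ A <;> by_cases h' : x ∈ A <;> simp_all

theorem consPath_mem_firstCross_zero (x : X) (ω : ℕ → X) :
    consPath x ω ∈ firstCross A 0 ↔ x ∉ A ∧ ω 0 ∈ A := by
  simp [firstCross]

theorem consPath_mem_firstCross_succ (x : X) (ω : ℕ → X) (k : ℕ) :
    consPath x ω ∈ firstCross A (k + 1) ↔ ¬ (x ∉ A ∧ ω 0 ∈ A) ∧ ω ∈ firstCross A k := by
  constructor
  · rintro ⟨h1, h2⟩
    exact ⟨h2 0 (Nat.succ_pos k), h1, fun j hj => h2 (j + 1) (by omega)⟩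
  · rintro ⟨h0, h1, h2⟩
    refine ⟨h1, ?_⟩
    rintro (_ | j) hj
    · exact h0
    · exact h2 j (by omega)

theorem lintegral_crossKernel (x : X) (f : X → ℝ≥0∞) :
    ∫⁻ y, f y ∂(crossKernel P hA x) =
      ∫⁻ y, {y | x ∉ A ∧ y ∈ A}.indicator f y ∂(P x) := by
  by_cases hx : x ∈ A
  · simp [crossKernel_of_mem P hA hx, hx]
  · rw [crossKernel_of_notMem P hA hx, ← lintegral_indicator hA]
    simp [hx]

theorem lintegral_stayKernel (x : X) (f : X → ℝ≥0∞) :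
    ∫⁻ y, f y ∂(stayKernel P hA x) =
      ∫⁻ y, {y | ¬ (x ∉ A ∧ y ∈ A)}.indicator f y ∂(P x) := by
  by_cases hx : x ∈ A
  · simp [stayKernel_of_mem P hA hx, hx]
  · rw [stayKernel_of_notMem P hA hx, ← lintegral_indicator hA.compl]
    simp only [hx, not_false_eq_true, true_and]
    rfl

theorem measurable_indicator_firstCross (hA : MeasurableSet A) {f : X → X → ℝ≥0∞}
    (hf : Measurable (Function.uncurry f)) (k : ℕ) :
    Measurable ((firstCross A k).indicator fun ω : ℕ → X => f (ω k) (ω (k + 1))) := by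
  have h : Measurable fun ω : ℕ → X => (ω k, ω (k + 1)) :=
    (measurable_pi_apply k).prodMk (measurable_pi_apply (k + 1))
  exact (hf.comp h).indicator (measurableSet_firstCross hA k)

/-- The expectation of a function of the two states at the first crossing, on the event that the
first crossing starts at time `k`. -/
theorem lintegral_firstCross (hA : MeasurableSet A) (k : ℕ) (x : X) {f : X → X → ℝ≥0∞}
    (hf : Measurable (Function.uncurry f)) :
    ∫⁻ ω, (firstCross A k).indicator (fun ω => f (ω k) (ω (k + 1))) ω ∂(chainLaw P x) =
      ∫⁻ y, ∫⁻ w, f y w ∂(crossKernel P hA y) ∂((stayKernel P hA ^ k) x) := by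
  have hmeas := measurable_indicator_firstCross hA hf
  have hC : Measurable fun y => ∫⁻ w, f y w ∂(crossKernel P hA y) := by
    have hf' : Measurable fun p : X × X => (A.indicator (fun w => f p.1 w) p.2 : ℝ≥0∞) := by
      have := hf.indicator (measurable_snd hA : MeasurableSet (Prod.snd ⁻¹' A : Set (X × X)))
      exact this
    have h1 : Measurable fun y => ∫⁻ w, A.indicator (fun w => f y w) w ∂(P y) :=
      Measurable.lintegral_kernel_prod_right (f := fun y w => A.indicator (fun w => f y w) w) hf'
    have h2 : (fun y => ∫⁻ w, f y w ∂(crossKernel P hA y)) =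
        Aᶜ.indicator fun y => ∫⁻ w, A.indicator (fun w => f y w) w ∂(P y) := by
      funext y
      by_cases hy : y ∈ A
      · simp [crossKernel_of_mem P hA hy, hy]
      · rw [indicator_of_mem (by exact hy), crossKernel_of_notMem P hA hy, lintegral_indicator hA]
    rw [h2]
    exact h1.indicator hA.compl
  induction k generalizing x with
  | zero =>
    rw [lintegral_pow_zero _ _ hC, lintegral_chainLaw P x (hmeas 0), lintegral_crossKernel]
    refine lintegral_congr fun y => ?_
    have hfx : Measurable (A.indicator (f x)) := (hf.comp measurable_prodMk_left).indicator hA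
    have : ∀ᵐ ω ∂(chainLaw P y), (firstCross A 0).indicator
        (fun ω : ℕ → X => f (ω 0) (ω (0 + 1))) (consPath x ω) =
        {y | x ∉ A ∧ y ∈ A}.indicator (f x) y := by
      filter_upwards [ae_chainLaw_zero P y hfx] with ω hω
      by_cases hx : x ∈ A
      · simp [indicator, consPath_mem_firstCross_zero, hx]
      · have h0 : consPath x ω ∈ firstCross A 0 ↔ ω 0 ∈ A := by
          simp [consPath_mem_firstCross_zero, hx]
        have h1 : {y | x ∉ A ∧ y ∈ A} = A := by simp [hx]
        rw [h1, ← hω]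
        by_cases h2 : ω 0 ∈ A
        · rw [indicator_of_mem h2, indicator_of_mem (h0.2 h2)]; rfl
        · rw [indicator_of_notMem h2, indicator_of_notMem (mt h0.1 h2)]
    rw [lintegral_congr_ae this]
    simp
  | succ k ih =>
    rw [lintegral_pow_succ _ _ _ hC, lintegral_chainLaw P x (hmeas (k + 1)), lintegral_stayKernel]
    refine lintegral_congr fun y => ?_
    have : ∀ᵐ ω ∂(chainLaw P y), (firstCross A (k + 1)).indicator
        (fun ω : ℕ → X => f (ω (k + 1)) (ω (k + 1 + 1))) (consPath x ω) =
        {y | ¬ (x ∉ A ∧ y ∈ A)}.indicator 1 y *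
          (firstCross A k).indicator (fun ω : ℕ → X => f (ω k) (ω (k + 1))) ω := by
      filter_upwards [ae_chainLaw_mem_iff P hA y] with ω hω
      by_cases hω' : ω ∈ firstCross A k <;> by_cases h : x ∉ A ∧ y ∈ A <;>
        simp [indicator, consPath_mem_firstCross_succ, hω, hω', h]
    rw [lintegral_congr_ae this, lintegral_const_mul _ (hmeas k), ih]
    by_cases h : x ∉ A ∧ y ∈ A <;> simp [indicator, h]

/-- The first-crossing events are disjoint, so at most one term of the sum survives, and none does
on paths that never cross. -/
theorem tsum_firstCross (F : (ℕ → X) → ℝ≥0∞) (f : ℕ → (ℕ → X) → ℝ≥0∞) (ω : ℕ → X)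
    (h1 : ∀ k, ω ∈ firstCross A k → F ω = f k ω)
    (h2 : (¬ ∃ k, ω k ∈ Aᶜ ∧ ω (k + 1) ∈ A) → F ω = 0) :
    F ω = ∑' k, (firstCross A k).indicator (f k) ω := by
  classical
  by_cases h : ∃ k, ω k ∈ Aᶜ ∧ ω (k + 1) ∈ A
  · have hk : ω ∈ firstCross A (Nat.find h) :=
      ⟨Nat.find_spec h, fun j hj => Nat.find_min h hj⟩
    rw [tsum_eq_single (Nat.find h), indicator_of_mem hk, h1 _ hk]
    intro j hj
    refine indicator_of_notMem (fun hjc => ?_) _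
    exact hj ((Nat.find_eq_iff h).2 hjc).symm
  · rw [h2 h]
    symm
    rw [ENNReal.tsum_eq_zero]
    exact fun k => indicator_of_notMem (fun hk => h ⟨k, hk.1⟩) _

theorem firstEntrance_of_mem_firstCross {k : ℕ} {ω : ℕ → X} (h : ω ∈ firstCross A k) :
    firstEntrance A ω = Sum.inl ⟨ω (k + 1), h.1.2⟩ := by
  classical
  have hex : ∃ k, ω k ∈ Aᶜ ∧ ω (k + 1) ∈ A := ⟨k, h.1⟩
  have hk : Nat.find hex = k := (Nat.find_eq_iff hex).2 h
  subst hk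
  unfold firstEntrance
  rw [dif_pos hex]

theorem firstExit_of_mem_firstCross {k : ℕ} {ω : ℕ → X} (h : ω ∈ firstCross A k) :
    firstExit A ω = Sum.inl ⟨ω k, h.1.1⟩ := by
  classical
  have hex : ∃ k, ω k ∈ Aᶜ ∧ ω (k + 1) ∈ A := ⟨k, h.1⟩
  have hk : Nat.find hex = k := (Nat.find_eq_iff hex).2 h
  subst hk
  unfold firstExit
  rw [dif_pos hex]

theorem lintegral_chainLaw_eq_green (hA : MeasurableSet A) (x : X) {F : (ℕ → X) → ℝ≥0∞}
    {f : X → X → ℝ≥0∞} (hf : Measurable (Function.uncurry f))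
    (h1 : ∀ ω k, ω ∈ firstCross A k → F ω = f (ω k) (ω (k + 1)))
    (h2 : ∀ ω, (¬ ∃ k, ω k ∈ Aᶜ ∧ ω (k + 1) ∈ A) → F ω = 0) :
    ∫⁻ ω, F ω ∂(chainLaw P x) =
      ∫⁻ y, ∫⁻ w, f y w ∂(crossKernel P hA y) ∂(greenKernel (stayKernel P hA) x) := by
  rw [lintegral_green, lintegral_congr fun ω => tsum_firstCross F
    (fun k ω => f (ω k) (ω (k + 1))) ω (h1 ω) (h2 ω), lintegral_tsum]
  · simp_rw [lintegral_firstCross P hA _ x hf]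
  · exact fun k => (measurable_indicator_firstCross hA hf k).aemeasurable

theorem measurable_elim_zero {E : Type*} [MeasurableSpace E] {f : E → ℝ≥0∞} (hf : Measurable f) :
    Measurable (Sum.elim f (fun _ => 0) : E ⊕ Unit → ℝ≥0∞) := hf.sumElim measurable_const

/-- The law of the first entrance position in terms of the Green kernel. -/
theorem lintegral_firstEntrance (x : X) {f : X → ℝ≥0∞} (hf : Measurable f) :
    ∫⁻ z, Sum.elim (fun a : A => f a) (fun _ => 0) z ∂((chainLaw P x).map (firstEntrance A)) =
      ∫⁻ y, ∫⁻ w, f w ∂(crossKernel P hA y) ∂(greenKernel (stayKernel P hA) x) := by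
  rw [lintegral_map (measurable_elim_zero (f := fun a : A => f a) (hf.comp measurable_subtype_coe))
    (measurable_firstEntrance hA)]
  refine lintegral_chainLaw_eq_green P hA x (f := fun _ w => f w) (hf.comp measurable_snd) ?_ ?_
  · intro ω k h
    rw [firstEntrance_of_mem_firstCross h]
    rfl
  · intro ω h
    unfold firstEntrance
    rw [dif_neg h]
    rfl

/-- The law of the first exit position in terms of the Green kernel. -/
theorem lintegral_firstExitKernel (x : X) {f : X → ℝ≥0∞} (hf : Measurable f) :
    ∫⁻ z, Sum.elim (fun a : ↥Aᶜ => f a) (fun _ => 0) z ∂(firstExitKernel P hA x) =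
      ∫⁻ y, f y * crossKernel P hA y univ ∂(greenKernel (stayKernel P hA) x) := by
  change ∫⁻ z, _ ∂((chainLaw P x).map (firstExit A)) = _
  rw [lintegral_map (measurable_elim_zero (f := fun a : ↥Aᶜ => f a)
    (hf.comp measurable_subtype_coe))
    (measurable_firstExit hA)]
  rw [lintegral_chainLaw_eq_green P hA x (f := fun y _ => f y) (hf.comp measurable_fst)]
  · simp
  · intro ω k h
    rw [firstExit_of_mem_firstCross h]
    rfl
  · intro ω h
    unfold firstExit
    rw [dif_neg h]
    rfl

end Crossing

/-! ### Consequences of the Liouville property for crossings -/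

section Liouville

variable {X : Type*} [MeasurableSpace X] (P : Kernel X X) [IsMarkovKernel P] {A : Set X}
  (hA : MeasurableSet A)

/-- The measure `μ` is invariant, bounded excessive functions are `μ`-a.e. constant, and
excessive measures dominated by `μ` are multiples of `μ`. -/
structure IsLiouville (P : Kernel X X) (μ : Measure X) : Prop where
  bind_eq : μ.bind P = μ
  function_const : ∀ F : X → ℝ≥0∞, Measurable F → (∀ x, F x ≤ 1) →
    (∀ x, ∫⁻ y, F y ∂(P x) ≤ F x) → ∃ c : ℝ≥0∞, ∀ᵐ x ∂μ, F x = c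
  measure_const : ∀ m : Measure X, m ≤ μ → m.bind P ≤ m → ∃ c : ℝ≥0∞, m = c • μ

theorem measurable_crossKernel_univ : Measurable fun x => crossKernel P hA x univ :=
  Kernel.measurable_coe _ MeasurableSet.univ

theorem crossKernel_univ_le_one (x : X) : crossKernel P hA x univ ≤ 1 := by
  have := congrArg (fun m => m univ) (stay_add_cross P hA x)
  rw [Measure.add_apply, measure_univ (μ := P x)] at this
  exact le_add_self.trans_eq this

/-- The potential of `w` is excessive if it is at most `w` on average after a crossing. -/
theorem lintegral_potential_le {w : X → ℝ≥0∞} (hw : Measurable w)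
    (h : ∀ x, ∫⁻ y, ∫⁻ z, w z ∂(greenKernel (stayKernel P hA) y) ∂(crossKernel P hA x) ≤ w x)
    (x : X) :
    ∫⁻ y, ∫⁻ z, w z ∂(greenKernel (stayKernel P hA) y) ∂(P x) ≤
      ∫⁻ z, w z ∂(greenKernel (stayKernel P hA) x) := by
  rw [lintegral_green_eq_add (stayKernel P hA) x hw, ← lintegral_stay_add_cross P hA, add_comm]
  gcongr
  exact h x

/-- The probability of ever crossing from `Aᶜ` to `A`. -/
def crossProb (x : X) : ℝ≥0∞ :=
  ∫⁻ y, crossKernel P hA y univ ∂(greenKernel (stayKernel P hA) x)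

theorem measurable_crossProb : Measurable (crossProb P hA) :=
  (measurable_crossKernel_univ P hA).lintegral_kernel

theorem lintegral_elim_le_one {E : Type*} [MeasurableSpace E] (m : Measure (E ⊕ Unit))
    [IsProbabilityMeasure m] {f : E → ℝ≥0∞} (hf : ∀ x, f x ≤ 1) :
    ∫⁻ z, Sum.elim f (fun _ => 0) z ∂m ≤ 1 := by
  calc ∫⁻ z, Sum.elim f (fun _ => 0) z ∂m ≤ ∫⁻ _, 1 ∂m := by
        refine lintegral_mono fun z => ?_
        rcases z with z | z
        · exact hf z
        · exact zero_le
    _ = 1 := by simp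

/-- The left side is the expectation of `f` at the first entrance position, with value 0 if there is
no entrance. -/
theorem lintegral_green_cross_le_one (x : X) {f : X → ℝ≥0∞} (hf : Measurable f)
    (hf1 : ∀ x, f x ≤ 1) :
    ∫⁻ y, ∫⁻ w, f w ∂(crossKernel P hA y) ∂(greenKernel (stayKernel P hA) x) ≤ 1 := by
  rw [← lintegral_firstEntrance P hA x hf]
  have := Measure.isProbabilityMeasure_map (μ := chainLaw P x)
    (measurable_firstEntrance hA).aemeasurable
  exact lintegral_elim_le_one _ fun a => hf1 a

theorem crossProb_le_one (x : X) : crossProb P hA x ≤ 1 := by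
  have := lintegral_green_cross_le_one P hA x (f := fun _ => 1) measurable_const fun _ => le_rfl
  simpa [crossProb] using this

variable {P} {μ : Measure X}

/-- Without crossings the chain started in Aᶜ stays there, which makes the restriction of μ to Aᶜ
excessive and hence a multiple of μ. This is impossible when both A and Aᶜ are charged. -/
theorem IsLiouville.bind_crossKernel_ne_zero (h : IsLiouville P μ) (h0 : μ A ≠ 0)
    (h1 : μ Aᶜ ≠ 0) : μ.bind (crossKernel P hA) ≠ 0 := by
  intro hz
  have hC : ∀ᵐ x ∂μ, crossKernel P hA x univ = 0 := by
    have := congrArg (fun m => m univ) hz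
    simp only [Measure.bind_apply MeasurableSet.univ (Kernel.measurable _).aemeasurable,
      Measure.coe_zero, Pi.zero_apply] at this
    rwa [lintegral_eq_zero_iff (measurable_crossKernel_univ P hA)] at this
  obtain ⟨c, hc⟩ := h.measure_const (μ.restrict Aᶜ) Measure.restrict_le_self (by
    refine Measure.le_iff.2 fun s hs => ?_
    have hA0 : (μ.restrict Aᶜ).bind P A = 0 := by
      rw [Measure.bind_apply hA P.measurable.aemeasurable,
        lintegral_eq_zero_iff (P.measurable_coe hA)]
      refine (ae_restrict_iff' hA.compl).2 ?_
      filter_upwards [hC] with x hx hxA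
      rw [← crossKernel_univ_of_notMem P hA hxA]
      exact hx
    calc (μ.restrict Aᶜ).bind P s
        ≤ (μ.restrict Aᶜ).bind P (s ∩ Aᶜ) + (μ.restrict Aᶜ).bind P A := by
          refine (measure_mono ?_).trans (measure_union_le _ _)
          intro x hx
          by_cases hxA : x ∈ A
          · exact Or.inr hxA
          · exact Or.inl ⟨hx, hxA⟩
      _ ≤ μ.bind P (s ∩ Aᶜ) := by
          rw [hA0, add_zero, Measure.bind_apply (hs.inter hA.compl) P.measurable.aemeasurable,
            Measure.bind_apply (hs.inter hA.compl) P.measurable.aemeasurable]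
          exact lintegral_mono' Measure.restrict_le_self le_rfl
      _ = μ.restrict Aᶜ s := by rw [h.bind_eq, Measure.restrict_apply hs])
  have e1 := congrArg (fun m => m A) hc
  have e2 := congrArg (fun m => m Aᶜ) hc
  simp only [Measure.restrict_apply hA, Measure.restrict_apply hA.compl, inter_compl_self,
    measure_empty, Measure.smul_apply, smul_eq_mul, inter_self] at e1 e2
  have hc0 : c = 0 := (mul_eq_zero.1 e1.symm).resolve_right h0
  rw [hc0, zero_mul] at e2
  exact h1 e2

theorem IsLiouville.ae_ae (h : IsLiouville P μ) {p : X → Prop} (hp : ∀ᵐ x ∂μ, p x) :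
    ∀ᵐ x ∂μ, ∀ᵐ y ∂(P x), p y := ae_ae_of_bind_eq h.bind_eq hp

theorem stayKernel_le (x : X) : stayKernel P hA x ≤ P x := by
  rw [← stay_add_cross P hA x]
  exact Measure.le_add_right le_rfl

/-- The chain almost surely crosses from `Aᶜ` to `A`. -/
theorem IsLiouville.ae_crossProb_eq_one (h : IsLiouville P μ) (h0 : μ A ≠ 0) (h1 : μ Aᶜ ≠ 0) :
    ∀ᵐ x ∂μ, crossProb P hA x = 1 := by
  obtain ⟨c, hc⟩ := h.function_const (crossProb P hA) (measurable_crossProb P hA)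
    (crossProb_le_one P hA) (lintegral_potential_le P hA (measurable_crossKernel_univ P hA) fun x =>
      (lintegral_mono fun y => crossProb_le_one P hA y).trans (by simp))
  suffices hc1 : c = 1 by rwa [hc1] at hc
  -- The constant is found at a point x where C(x) = C(x, X) is positive: with Q(x) = 1 - C(x), the
  -- first-step equation c = C(x) + c Q(x) gives c C(x) = C(x), so c = 1.
  have hne : ∃ᵐ x ∂μ, crossKernel P hA x univ ≠ 0 := by
    intro hcon
    refine bind_crossKernel_ne_zero hA h h0 h1 (Measure.measure_univ_eq_zero.1 ?_)
    rw [Measure.bind_apply MeasurableSet.univ (Kernel.measurable _).aemeasurable,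
      lintegral_eq_zero_iff (measurable_crossKernel_univ P hA)]
    exact hcon.mono fun x hx => not_not.1 hx
  obtain ⟨x, hx0, hx1, hx2⟩ := (hne.and_eventually (hc.and (h.ae_ae hc))).exists
  have hc' : c ≤ 1 := hx1 ▸ crossProb_le_one P hA x
  have hcfin : c ≠ ∞ := (hc'.trans_lt ENNReal.one_lt_top).ne
  have e1 : crossProb P hA x = crossKernel P hA x univ + c * stayKernel P hA x univ := by
    rw [crossProb, lintegral_green_eq_add _ _ (measurable_crossKernel_univ P hA)]
    congr 1
    rw [← lintegral_const]
    exact lintegral_congr_ae ((stayKernel_le hA x).absolutelyContinuous.ae_le hx2)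
  have e2 : stayKernel P hA x univ + crossKernel P hA x univ = 1 := by
    rw [← Measure.add_apply, stay_add_cross, measure_univ]
  have hle := crossKernel_univ_le_one P hA x
  have hCfin : crossKernel P hA x univ ≠ ∞ := (hle.trans_lt ENNReal.one_lt_top).ne
  have hQfin : stayKernel P hA x univ ≠ ∞ :=
    ((le_self_add.trans_eq e2).trans_lt ENNReal.one_lt_top).ne
  have e3 : c * crossKernel P hA x univ + c * stayKernel P hA x univ =
      1 * crossKernel P hA x univ + c * stayKernel P hA x univ := by
    rw [← mul_add, add_comm, e2, mul_one, one_mul, ← e1, hx1]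
  exact (ENNReal.mul_left_inj hx0 hCfin).1
    ((ENNReal.add_left_inj (ENNReal.mul_ne_top hcfin hQfin)).1 e3)

/-- An invariant measure of the chain is the Green potential of its entrance measure. -/
theorem IsLiouville.bind_cross_bind_green [SigmaFinite μ] (h : IsLiouville P μ) (h0 : μ A ≠ 0)
    (h1 : μ Aᶜ ≠ 0) :
    (μ.bind (crossKernel P hA)).bind (greenKernel (stayKernel P hA)) = μ := by
  set ζ := μ.bind (crossKernel P hA) with hζ
  set m := ζ.bind (greenKernel (stayKernel P hA)) with hm
  have hμ : ζ + μ.bind (stayKernel P hA) = μ := by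
    rw [add_comm, hζ, bind_stay_add_cross, h.bind_eq]
  -- Invariance of μ reads μ = ζ + μQ, and m is the minimal solution of this equation. Being
  -- excessive and below μ, m must equal cμ.
  have hle : m ≤ μ := bind_green_le _ hμ
  have hmeq : m = ζ + m.bind (stayKernel P hA) := bind_green_eq_add _ ζ
  have hmP : m.bind P ≤ m := by
    rw [← bind_stay_add_cross P hA]
    conv_rhs => rw [hmeq]
    rw [add_comm]
    gcongr
    refine Measure.le_iff.2 fun s hs => ?_
    rw [hζ, Measure.bind_apply hs (Kernel.measurable _).aemeasurable,
      Measure.bind_apply hs (Kernel.measurable _).aemeasurable]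
    exact lintegral_mono' hle le_rfl
  obtain ⟨c, hc⟩ := h.measure_const m hle hmP
  suffices hc1 : c = 1 by rw [hc, hc1, one_smul]
  have hζ0 : ζ ≠ 0 := bind_crossKernel_ne_zero hA h h0 h1
  -- Comparing μ = ζ + μQ with cμ = ζ + cμQ requires cancellation, so both are evaluated on a set of
  -- finite μ-measure that ζ charges.
  obtain ⟨n, hn⟩ : ∃ n, ζ (spanningSets μ n) ≠ 0 := by
    by_contra! hcon
    refine hζ0 (Measure.measure_univ_eq_zero.1 ?_)
    rw [← iUnion_spanningSets μ]
    exact measure_iUnion_null hcon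
  set S := spanningSets μ n
  have hSm : MeasurableSet S := measurableSet_spanningSets μ n
  have hS : μ S < ∞ := measure_spanningSets_lt_top μ n
  have a1 : ζ S + μ.bind (stayKernel P hA) S = μ S := by
    rw [← Measure.add_apply, hμ]
  have a2 : m S = c * μ S := by rw [hc]; rfl
  have a3 : m S = ζ S + c * μ.bind (stayKernel P hA) S := by
    conv_lhs => rw [hmeq]
    rw [Measure.add_apply]
    congr 1
    rw [hc, Measure.bind_apply hSm (Kernel.measurable _).aemeasurable, lintegral_smul_measure,
      Measure.bind_apply hSm (Kernel.measurable _).aemeasurable]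
    rfl
  have hfin1 : ζ S ≠ ∞ := ((le_self_add.trans_eq a1).trans_lt hS).ne
  have hfin2 : c * μ.bind (stayKernel P hA) S ≠ ∞ :=
    ((le_add_self.trans_eq a3.symm).trans_lt ((hle S).trans_lt hS)).ne
  have a4 : c * ζ S + c * μ.bind (stayKernel P hA) S =
      1 * ζ S + c * μ.bind (stayKernel P hA) S := by
    rw [← mul_add, a1, ← a2, a3, one_mul]
  exact (ENNReal.mul_left_inj hn hfin1).1 ((ENNReal.add_left_inj hfin2).1 a4)

end Liouville

/-! ### Measures and chains on the space with a cemetery -/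

section Cemetery

variable {E : Type*} [MeasurableSpace E] {K : Kernel (E ⊕ Unit) (E ⊕ Unit)} [IsMarkovKernel K]
  {ν : Measure E}

theorem measurableEmbedding_inl : MeasurableEmbedding (Sum.inl : E → E ⊕ Unit) :=
  ⟨Sum.inl_injective, measurable_inl, fun _ hs => measurableSet_inl_image.2 hs⟩

theorem apply_image_inl_univ (m : Measure (E ⊕ Unit)) [IsProbabilityMeasure m] :
    m (Sum.inl '' univ) = 1 ↔ m {Sum.inr ()} = 0 := by
  have h : {(Sum.inr () : E ⊕ Unit)} = (Sum.inl '' (univ : Set E))ᶜ := by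
    ext z
    rcases z with z | z <;> simp
  rw [h, prob_compl_eq_zero_iff (measurableSet_inl_image.2 MeasurableSet.univ)]

/-- `IsInvariant` tests only subsets of `E`. It becomes invariance on `E ⊕ Unit` because no mass
escapes to the cemetery, as `h0` asserts. -/
theorem bind_map_inl (hinv : IsInvariant K ν) (h0 : ∀ᵐ x ∂ν, K (Sum.inl x) {Sum.inr ()} = 0) :
    (ν.map Sum.inl).bind K = ν.map Sum.inl := by
  ext s hs
  have hs' : MeasurableSet (Sum.inl ⁻¹' s : Set E) := measurable_inl hs
  rw [Measure.bind_apply hs K.measurable.aemeasurable,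
    lintegral_map (K.measurable_coe hs) measurable_inl, Measure.map_apply measurable_inl hs,
    ← hinv _ hs']
  refine lintegral_congr_ae ?_
  filter_upwards [h0] with x hx
  refine measure_congr ?_
  filter_upwards [measure_eq_zero_iff_ae_notMem.1 hx] with z hz
  apply propext
  rcases z with z | z
  · constructor
    · intro h
      exact ⟨z, h, rfl⟩
    · rintro ⟨y, hy, hyz⟩
      have := Sum.inl_injective hyz
      subst this
      exact hy
  · exact absurd rfl hz

theorem isRecurrent_of_excessiveConst (hinv : (ν.map Sum.inl).bind K = ν.map Sum.inl)
    (h : ExcessiveConst K (ν.map Sum.inl)) : IsRecurrent K ν := by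
  intro B hB _
  have := recurrent_of_excessiveConst hinv h (measurableSet_inl_image.2 hB)
  rw [measurableEmbedding_inl.ae_map_iff] at this
  exact this.mono fun x hx hxB => hx ⟨x, hxB, rfl⟩

end Cemetery

/-! ### Passing between a measurable subset and the whole space -/

section Subtype

variable {X : Type*} [MeasurableSpace X] {S : Set X}

theorem ae_comap_val (hS : MeasurableSet S) {m : Measure X} {p : X → Prop}
    (h : ∀ᵐ x ∂m, p x) : ∀ᵐ a : S ∂(m.comap Subtype.val), p a := by
  have h1 := (MeasurableEmbedding.subtype_coe hS).map_comap m
  refine ((MeasurableEmbedding.subtype_coe hS).ae_map_iff (p := p)).1 ?_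
  rw [h1]
  exact ae_restrict_of_ae h

theorem map_comap_val (hS : MeasurableSet S) {m : Measure X} (hm : m Sᶜ = 0) :
    (m.comap (Subtype.val : S → X)).map Subtype.val = m := by
  rw [(MeasurableEmbedding.subtype_coe hS).map_comap, Subtype.range_coe,
    Measure.restrict_eq_self_of_ae_mem]
  exact measure_eq_zero_iff_ae_notMem.1 hm |>.mono fun x hx => not_not.1 hx

theorem map_val_compl (hS : MeasurableSet S) (η : Measure S) : η.map Subtype.val Sᶜ = 0 := by
  rw [Measure.map_apply measurable_subtype_coe hS.compl]
  convert measure_empty (μ := η)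
  ext a; simp

/-- Two measures concentrated on `S` are equal if they agree on the subsets of `S`. -/
theorem eq_of_forall_image_val (hS : MeasurableSet S) {m m' : Measure X} (hm : m Sᶜ = 0)
    (hm' : m' Sᶜ = 0)
    (h : ∀ B : Set S, MeasurableSet B → m (Subtype.val '' B) = m' (Subtype.val '' B)) :
    m = m' := by
  rw [← map_comap_val hS hm, ← map_comap_val hS hm']
  congr 1
  ext B hB
  rw [(MeasurableEmbedding.subtype_coe hS).comap_apply,
    (MeasurableEmbedding.subtype_coe hS).comap_apply]
  exact h B hB

/-- Extension by zero of a function on `E ∪ {†}`. -/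
def extendZero (f : S ⊕ Unit → ℝ≥0∞) : X → ℝ≥0∞ :=
  Function.extend Subtype.val (f ∘ Sum.inl) 0

theorem extendZero_val (f : S ⊕ Unit → ℝ≥0∞) (a : S) : extendZero f a = f (Sum.inl a) :=
  Subtype.val_injective.extend_apply _ _ _

theorem measurable_extendZero (hS : MeasurableSet S) {f : S ⊕ Unit → ℝ≥0∞} (hf : Measurable f) :
    Measurable (extendZero f) :=
  (MeasurableEmbedding.subtype_coe hS).measurable_extend (hf.comp measurable_inl) measurable_const

theorem extendZero_le_one {f : S ⊕ Unit → ℝ≥0∞} (hf : ∀ z, f z ≤ 1) (x : X) :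
    extendZero f x ≤ 1 := by
  by_cases hx : x ∈ S
  · rw [show x = (⟨x, hx⟩ : S).1 from rfl, extendZero_val]
    exact hf _
  · rw [extendZero, Function.extend_apply']
    · exact zero_le
    · rintro ⟨a, rfl⟩
      exact hx a.2

theorem elim_extendZero_le (f : S ⊕ Unit → ℝ≥0∞) (z : S ⊕ Unit) :
    Sum.elim (fun a : S => extendZero f a) (fun _ => 0) z ≤ f z := by
  rcases z with z | z
  · exact (extendZero_val f z).le
  · exact zero_le

theorem lintegral_elim_extendZero (f : S ⊕ Unit → ℝ≥0∞) {m : Measure (S ⊕ Unit)}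
    (hm : m {Sum.inr ()} = 0) :
    ∫⁻ z, Sum.elim (fun a : S => extendZero f a) (fun _ => 0) z ∂m = ∫⁻ z, f z ∂m := by
  refine lintegral_congr_ae ?_
  filter_upwards [measure_eq_zero_iff_ae_notMem.1 hm] with z hz
  rcases z with z | z
  · exact extendZero_val f z
  · exact absurd rfl hz

theorem elim_indicator_image (B : Set S) (z : S ⊕ Unit) :
    Sum.elim (fun a : S => (Subtype.val '' B : Set X).indicator (1 : X → ℝ≥0∞) a) (fun _ => 0) z =
      (Sum.inl '' B : Set (S ⊕ Unit)).indicator 1 z := by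
  rcases z with z | z
  · by_cases hz : z ∈ B <;> simp [indicator, hz]
  · simp

theorem measure_image_inl {B : Set S} (hB : MeasurableSet B) (m : Measure (S ⊕ Unit)) :
    m (Sum.inl '' B) = ∫⁻ z, Sum.elim
      (fun a : S => (Subtype.val '' B : Set X).indicator (1 : X → ℝ≥0∞) a) (fun _ => 0) z ∂m := by
  rw [← lintegral_indicator_one (measurableSet_inl_image.2 hB)]
  exact lintegral_congr fun z => (elim_indicator_image B z).symm

end Subtype

/-! ### The entrance chain -/

section Entrance

variable {X : Type*} [MeasurableSpace X] {P : Kernel X X} [IsMarkovKernel P] {A : Set X}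
  (hA : MeasurableSet A) {μ : Measure X}

theorem entranceMeasure_eq :
    entranceMeasure P μ A = (μ.bind (crossKernel P hA)).comap Subtype.val := by
  ext B hB
  have hB' : MeasurableSet (Subtype.val '' B : Set X) := hA.subtype_image hB
  rw [entranceMeasure, (MeasurableEmbedding.subtype_coe hA).comap_apply,
    (MeasurableEmbedding.subtype_coe hA).comap_apply,
    Measure.bind_apply hB' P.measurable.aemeasurable,
    Measure.bind_apply hB' (Kernel.measurable _).aemeasurable, ← lintegral_indicator hA.compl]
  refine lintegral_congr fun x => ?_
  by_cases hx : x ∈ A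
  · simp [crossKernel_of_mem P hA hx, hx]
  · rw [indicator_of_mem (by exact hx), crossKernel_of_notMem P hA hx,
      Measure.restrict_apply hB', inter_eq_self_of_subset_left]
    rintro _ ⟨a, _, rfl⟩
    exact a.2

theorem lintegral_entranceKernel (x : A) {f : X → ℝ≥0∞} (hf : Measurable f) :
    ∫⁻ z, Sum.elim (fun a : A => f a) (fun _ => 0) z ∂(entranceKernel P hA (Sum.inl x)) =
      ∫⁻ y, ∫⁻ w, f w ∂(crossKernel P hA y) ∂(greenKernel (stayKernel P hA) x) :=
  lintegral_firstEntrance P hA x.1 hf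

theorem entranceKernel_image_univ (x : A) :
    entranceKernel P hA (Sum.inl x) (Sum.inl '' univ) = crossProb P hA x := by
  have := lintegral_entranceKernel hA (P := P) x (f := fun _ => 1) measurable_const
  simp only [lintegral_const, one_mul] at this
  rw [crossProb, ← this, ← lintegral_indicator_one (measurableSet_inl_image.2 MeasurableSet.univ)]
  refine lintegral_congr fun z => ?_
  rcases z with z | z <;> simp

/-- Viewed on `X`, one step of the entrance chain is the Green kernel followed by a crossing. -/
theorem isInvariant_entranceKernel_iff (η : Measure A) :
    IsInvariant (entranceKernel P hA) η ↔
      ((η.map Subtype.val).bind (greenKernel (stayKernel P hA))).bind (crossKernel P hA) =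
        η.map Subtype.val := by
  have key : ∀ B : Set A, MeasurableSet B →
      ∫⁻ x, entranceKernel P hA (Sum.inl x) (Sum.inl '' B) ∂η =
      ((η.map Subtype.val).bind (greenKernel (stayKernel P hA))).bind (crossKernel P hA)
        (Subtype.val '' B) := by
    intro B hB
    have hB' : MeasurableSet (Subtype.val '' B : Set X) := hA.subtype_image hB
    have hm := Kernel.measurable_coe (crossKernel P hA) hB'
    rw [Measure.bind_apply hB' (Kernel.measurable _).aemeasurable,
      lintegral_bind_kernel _ _ hm, lintegral_map hm.lintegral_kernel measurable_subtype_coe]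
    refine lintegral_congr fun x => ?_
    rw [measure_image_inl (X := X) hB, lintegral_entranceKernel hA x (measurable_one.indicator hB')]
    simp_rw [lintegral_indicator_one hB']
  have hη : ∀ B : Set A, η.map Subtype.val (Subtype.val '' B : Set X) = η B := fun B => by
    rw [(MeasurableEmbedding.subtype_coe hA).map_apply,
      preimage_image_eq _ Subtype.val_injective]
  constructor
  · intro h
    refine eq_of_forall_image_val hA (bind_crossKernel_compl P hA _) (map_val_compl hA η) ?_
    intro B hB
    rw [← key B hB, h B hB, hη]
  · intro h B hB
    rw [key B hB, h, hη]

/-- The bound μC ≤ μP = μ lets μ-a.e. statements be used a.e. for the entrance measure. -/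
theorem bind_crossKernel_absolutelyContinuous (h : IsLiouville P μ) :
    μ.bind (crossKernel P hA) ≪ μ := by
  have hle : μ.bind (crossKernel P hA) ≤ μ := by
    conv_rhs => rw [← h.bind_eq, ← bind_stay_add_cross P hA]
    exact Measure.le_add_left le_rfl
  exact hle.absolutelyContinuous

theorem IsLiouville.isInvariant_entrance [SigmaFinite μ] (h : IsLiouville P μ) (h0 : μ A ≠ 0)
    (h1 : μ Aᶜ ≠ 0) : IsInvariant (entranceKernel P hA) (entranceMeasure P μ A) := by
  rw [isInvariant_entranceKernel_iff, entranceMeasure_eq hA,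
    map_comap_val hA (bind_crossKernel_compl P hA μ), h.bind_cross_bind_green hA h0 h1]

theorem IsLiouville.ae_entrance_cemetery (h : IsLiouville P μ) (h0 : μ A ≠ 0) (h1 : μ Aᶜ ≠ 0) :
    ∀ᵐ x ∂(entranceMeasure P μ A), entranceKernel P hA (Sum.inl x) {Sum.inr ()} = 0 := by
  rw [entranceMeasure_eq hA]
  have := ae_comap_val hA ((bind_crossKernel_absolutelyContinuous hA h).ae_le
    (h.ae_crossProb_eq_one hA h0 h1))
  refine this.mono fun x hx => ?_
  rw [← apply_image_inl_univ, entranceKernel_image_univ]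
  exact hx

/-- Put w = Cf and u = Gw, so that u = Kf on A for the entrance kernel K. After a crossing the state
lies in A, where u ≤ f, whence Cu ≤ w and Pu = Qu + Cu ≤ Qu + w = u. Thus u is excessive for P and
a.e. constant. Extending f by zero off A discards the value at the cemetery, which a.e. is never
reached. -/
theorem IsLiouville.excessiveConst_entrance (h : IsLiouville P μ) (h0 : μ A ≠ 0)
    (h1 : μ Aᶜ ≠ 0) :
    ExcessiveConst (entranceKernel P hA) ((entranceMeasure P μ A).map Sum.inl) := by
  intro f hf hf1 hle
  have hfe := measurable_extendZero hA hf
  have hw : Measurable fun y => ∫⁻ w, extendZero f w ∂(crossKernel P hA y) :=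
    hfe.lintegral_kernel
  obtain ⟨c, hc⟩ := h.function_const
    (fun x => ∫⁻ y, ∫⁻ w, extendZero f w ∂(crossKernel P hA y) ∂(greenKernel (stayKernel P hA) x))
    hw.lintegral_kernel
    (fun x => lintegral_green_cross_le_one P hA x hfe (extendZero_le_one hf1))
    (lintegral_potential_le P hA hw fun x => by
      refine lintegral_mono_ae ?_
      have hmem : ∀ᵐ y ∂(crossKernel P hA x), y ∈ A :=
        (measure_eq_zero_iff_ae_notMem.1 (crossKernel_apply_compl P hA x)).mono
          fun y hy => not_not.1 hy
      filter_upwards [hmem] with y hy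
      rw [show y = (⟨y, hy⟩ : A).1 from rfl, ← lintegral_entranceKernel hA _ hfe, extendZero_val]
      exact (lintegral_mono (elim_extendZero_le f)).trans (hle _))
  refine ⟨c, ?_⟩
  rw [measurableEmbedding_inl.ae_map_iff]
  have hc' := ae_comap_val hA ((bind_crossKernel_absolutelyContinuous hA h).ae_le hc)
  rw [← entranceMeasure_eq hA] at hc'
  filter_upwards [hc', h.ae_entrance_cemetery hA h0 h1] with x hx hx0
  rw [← lintegral_elim_extendZero f hx0, lintegral_entranceKernel hA _ hfe]
  exact hx

/-- Invariant measures of the entrance chain lift to P-invariant ones: with m = ζG and mC = ζ, one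
has mP = mQ + ζ = m. This drives uniqueness for both chains. -/
theorem bind_eq_of_bind_green (ζ : Measure X)
    (h : (ζ.bind (greenKernel (stayKernel P hA))).bind (crossKernel P hA) = ζ) :
    (ζ.bind (greenKernel (stayKernel P hA))).bind P = ζ.bind (greenKernel (stayKernel P hA)) := by
  rw [← bind_stay_add_cross P hA, h, add_comm, ← bind_green_eq_add]

end Entrance

/-! ### The exit chain -/

section Exit

variable {X : Type*} [MeasurableSpace X] (P : Kernel X X) [IsMarkovKernel P] {A : Set X}
  (hA : MeasurableSet A)

/-- The transition probabilities conditioned on the next state being in `A`. -/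
def condKernel : Kernel X X where
  toFun x := cond (P x) A
  measurable' := by
    refine Measure.measurable_of_measurable_coe _ fun s hs => ?_
    simp only [cond_apply hA]
    exact (P.measurable_coe hA).inv.mul (P.measurable_coe (hA.inter hs))

theorem condKernel_apply (x : X) : condKernel P hA x = cond (P x) A := rfl

/-- This undoes the normalization of the conditioning. If P(x, A) = 0, the conditional measure is
zero and both sides vanish. -/
theorem crossKernel_univ_mul_lintegral_condKernel (x : X) (f : X → ℝ≥0∞) :
    crossKernel P hA x univ * ∫⁻ z, f z ∂(condKernel P hA x) =
      ∫⁻ z, f z ∂(crossKernel P hA x) := by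
  by_cases hx : x ∈ A
  · simp [crossKernel_of_mem P hA hx]
  · rw [crossKernel_univ_of_notMem P hA hx, crossKernel_of_notMem P hA hx, condKernel_apply]
    by_cases h0 : P x A = 0
    · rw [Measure.restrict_eq_zero.2 h0, h0]; simp
    · rw [ProbabilityTheory.cond, lintegral_smul_measure, smul_eq_mul, ← mul_assoc,
        ENNReal.mul_inv_cancel h0 (measure_ne_top _ _), one_mul]

/-- The measure `m(dx) P(x, A)` on `Aᶜ`, as a measure on the whole state space. -/
def exitDensity (m : Measure X) : Measure X := m.withDensity fun x => crossKernel P hA x univ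

theorem lintegral_exitDensity (m : Measure X) {f : X → ℝ≥0∞} (hf : Measurable f) :
    ∫⁻ x, f x ∂(exitDensity P hA m) = ∫⁻ x, f x * crossKernel P hA x univ ∂m := by
  rw [exitDensity, lintegral_withDensity_eq_lintegral_mul _ (measurable_crossKernel_univ P hA) hf]
  exact lintegral_congr fun x => mul_comm _ _

theorem exitDensity_bind_condKernel (m : Measure X) :
    (exitDensity P hA m).bind (condKernel P hA) = m.bind (crossKernel P hA) := by
  refine Measure.ext_of_lintegral _ fun f hf => ?_
  rw [lintegral_bind_kernel _ _ hf, lintegral_bind_kernel _ _ hf,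
    lintegral_exitDensity P hA m hf.lintegral_kernel]
  exact lintegral_congr fun x => (mul_comm _ _).trans
    (crossKernel_univ_mul_lintegral_condKernel P hA x f)

theorem exitDensity_apply_self (m : Measure X) : exitDensity P hA m A = 0 := by
  rw [exitDensity, withDensity_apply _ hA, ← lintegral_indicator hA]
  refine (lintegral_congr fun x => ?_).trans lintegral_zero
  by_cases hx : x ∈ A
  · simp [crossKernel_of_mem P hA hx]
  · simp [hx]

variable {P} {μ : Measure X}

theorem exitMeasure_eq : exitMeasure P μ A = (exitDensity P hA μ).comap Subtype.val := by
  ext B hB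
  have hB' : MeasurableSet (Subtype.val '' B : Set X) := hA.compl.subtype_image hB
  rw [exitMeasure, (MeasurableEmbedding.subtype_coe hA.compl).comap_apply,
    (MeasurableEmbedding.subtype_coe hA.compl).comap_apply, exitDensity,
    withDensity_apply _ hB', withDensity_apply _ hB']
  refine setLIntegral_congr_fun hB' ?_
  rintro _ ⟨a, _, rfl⟩
  exact (crossKernel_univ_of_notMem P hA a.2).symm

theorem lintegral_exitKernel (x : ↥Aᶜ) {f : X → ℝ≥0∞} (hf : Measurable f) :
    ∫⁻ z, Sum.elim (fun a : ↥Aᶜ => f a) (fun _ => 0) z ∂(exitKernel P hA (Sum.inl x)) =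
      ∫⁻ z, ∫⁻ y, f y * crossKernel P hA y univ ∂(greenKernel (stayKernel P hA) z)
        ∂(condKernel P hA x) := by
  classical
  have hG := measurable_elim_zero (f := fun a : ↥Aᶜ => f a)
    (hf.comp measurable_subtype_coe)
  have hdef : exitKernel P hA (Sum.inl x) = if P x.1 A = 0 then Measure.dirac (Sum.inr ())
      else (cond (P x.1) A).bind (firstExitKernel P hA) := by
    change (if _ then _ else _) = _
    congr
  rw [hdef, condKernel_apply]
  split_ifs with h
  -- The jump to the cemetery contributes 0 on the left; the conditional law is the zero measure on
  -- the right.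
  · rw [lintegral_dirac' _ hG, cond_eq_zero_of_meas_eq_zero h]
    simp
  · rw [Measure.lintegral_bind (Kernel.measurable _).aemeasurable hG.aemeasurable]
    exact lintegral_congr fun z => lintegral_firstExitKernel P hA z hf

theorem exitKernel_image_univ (x : ↥Aᶜ) :
    exitKernel P hA (Sum.inl x) (Sum.inl '' univ) =
      ∫⁻ z, crossProb P hA z ∂(condKernel P hA x) := by
  have := lintegral_exitKernel hA (P := P) x (f := fun _ => 1) measurable_const
  simp only [one_mul] at this
  unfold crossProb
  rw [← this, ← lintegral_indicator_one (measurableSet_inl_image.2 MeasurableSet.univ)]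
  refine lintegral_congr fun z => ?_
  rcases z with z | z <;> simp

/-- One exit step consists of the conditioned jump into A, the Green kernel, and the weight P(y, A)
that selects the last position before a crossing. -/
theorem isInvariant_exitKernel_iff (η : Measure ↥Aᶜ) :
    IsInvariant (exitKernel P hA) η ↔
      exitDensity P hA (((η.map Subtype.val).bind (condKernel P hA)).bind
        (greenKernel (stayKernel P hA))) = η.map Subtype.val := by
  have hAc := hA.compl
  have key : ∀ B : Set ↥Aᶜ, MeasurableSet B →
      ∫⁻ x, exitKernel P hA (Sum.inl x) (Sum.inl '' B) ∂η =
      exitDensity P hA (((η.map Subtype.val).bind (condKernel P hA)).bind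
        (greenKernel (stayKernel P hA))) (Subtype.val '' B) := by
    intro B hB
    have hB' : MeasurableSet (Subtype.val '' B : Set X) := hAc.subtype_image hB
    have hi : Measurable ((Subtype.val '' B : Set X).indicator (1 : X → ℝ≥0∞)) :=
      measurable_one.indicator hB'
    have hm : Measurable fun x => (Subtype.val '' B : Set X).indicator (1 : X → ℝ≥0∞) x *
        crossKernel P hA x univ := hi.mul (measurable_crossKernel_univ P hA)
    rw [← lintegral_indicator_one hB', lintegral_exitDensity _ _ _ hi,
      lintegral_bind_kernel _ _ hm, lintegral_bind_kernel _ _ hm.lintegral_kernel,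
      lintegral_map hm.lintegral_kernel.lintegral_kernel measurable_subtype_coe]
    refine lintegral_congr fun x => ?_
    rw [measure_image_inl (X := X) hB, lintegral_exitKernel hA x hi]
  have hη : ∀ B : Set ↥Aᶜ, η.map Subtype.val (Subtype.val '' B : Set X) = η B := fun B => by
    rw [(MeasurableEmbedding.subtype_coe hAc).map_apply,
      preimage_image_eq _ Subtype.val_injective]
  constructor
  · intro h
    refine eq_of_forall_image_val hAc ?_ (map_val_compl hAc η) ?_
    · rw [compl_compl]; exact exitDensity_apply_self P hA _
    intro B hB
    rw [← key B hB, h B hB, hη]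
  · intro h B hB
    rw [key B hB, h, hη]

theorem exitDensity_compl_compl (m : Measure X) : exitDensity P hA m Aᶜᶜ = 0 := by
  rw [compl_compl]; exact exitDensity_apply_self P hA m

theorem IsLiouville.isInvariant_exit [SigmaFinite μ] (h : IsLiouville P μ) (h0 : μ A ≠ 0)
    (h1 : μ Aᶜ ≠ 0) : IsInvariant (exitKernel P hA) (exitMeasure P μ A) := by
  rw [isInvariant_exitKernel_iff, exitMeasure_eq hA,
    map_comap_val hA.compl (exitDensity_compl_compl hA μ), exitDensity_bind_condKernel,
    h.bind_cross_bind_green hA h0 h1]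

/-- The exit measure has density P(x, A) on Aᶜ, so points with P(x, A) = 0 are negligible for it and
μ-a.e. information elsewhere suffices. -/
theorem ae_exitMeasure (hA : MeasurableSet A) {p : X → Prop} (h : ∀ᵐ x ∂μ, P x A ≠ 0 → p x) :
    ∀ᵐ x : ↥Aᶜ ∂(exitMeasure P μ A), P x.1 A ≠ 0 ∧ p x.1 := by
  rw [exitMeasure_eq hA]
  have : ∀ᵐ x ∂(exitDensity P hA μ), x ∉ A → P x A ≠ 0 ∧ p x := by
    rw [exitDensity, ae_withDensity_iff (measurable_crossKernel_univ P hA)]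
    filter_upwards [h] with x hx hx0 hxA
    rw [crossKernel_univ_of_notMem P hA hxA] at hx0
    exact ⟨hx0, hx hx0⟩
  exact (ae_comap_val hA.compl this).mono fun x hx => hx x.2

theorem lintegral_condKernel_const {x : X} (hx : P x A ≠ 0) {g : X → ℝ≥0∞} {c : ℝ≥0∞}
    (hg : ∀ᵐ y ∂(P x), g y = c) : ∫⁻ z, g z ∂(condKernel P hA x) = c := by
  have := cond_isProbabilityMeasure hx
  rw [condKernel_apply, lintegral_congr_ae (cond_absolutelyContinuous.ae_le hg)]
  simp

theorem IsLiouville.ae_exit_cemetery (h : IsLiouville P μ) (h0 : μ A ≠ 0) (h1 : μ Aᶜ ≠ 0) :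
    ∀ᵐ x ∂(exitMeasure P μ A), exitKernel P hA (Sum.inl x) {Sum.inr ()} = 0 := by
  have := ae_exitMeasure (P := P) hA (p := fun x => ∀ᵐ y ∂(P x), crossProb P hA y = 1)
    ((h.ae_ae (h.ae_crossProb_eq_one hA h0 h1)).mono fun x hx _ => hx)
  refine this.mono fun x hx => ?_
  rw [← apply_image_inl_univ (exitKernel P hA (Sum.inl x)), exitKernel_image_univ hA]
  exact lintegral_condKernel_const hA hx.1 hx.2

/-- Here u = Gw with w(y) = f(y) C(y, X), and the exit kernel gives Kf = Ju, where J is the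
conditioned jump into A. Excessivity of f gives Cu = C(·, X) Ju ≤ w, so u is excessive for P, hence
a.e. constant, and Ju is the same constant at exit-a.e. point. -/
theorem IsLiouville.excessiveConst_exit (h : IsLiouville P μ) (h0 : μ A ≠ 0)
    (h1 : μ Aᶜ ≠ 0) :
    ExcessiveConst (exitKernel P hA) ((exitMeasure P μ A).map Sum.inl) := by
  intro f hf hf1 hle
  have hfe := measurable_extendZero hA.compl hf
  have hw : Measurable fun y => extendZero f y * crossKernel P hA y univ :=
    hfe.mul (measurable_crossKernel_univ P hA)
  obtain ⟨c, hc⟩ := h.function_const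
    (fun x => ∫⁻ y, extendZero f y * crossKernel P hA y univ ∂(greenKernel (stayKernel P hA) x))
    hw.lintegral_kernel
    (fun x => by
      rw [← lintegral_firstExitKernel P hA x hfe]
      exact lintegral_elim_le_one _ fun a => extendZero_le_one hf1 a)
    (lintegral_potential_le P hA hw fun x => by
      rw [← crossKernel_univ_mul_lintegral_condKernel, mul_comm]
      by_cases hx : x ∈ A
      · simp [crossKernel_of_mem P hA hx]
      · gcongr
        rw [show x = (⟨x, hx⟩ : ↥Aᶜ).1 from rfl, ← lintegral_exitKernel hA _ hfe, extendZero_val]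
        exact (lintegral_mono (elim_extendZero_le f)).trans (hle _))
  refine ⟨c, ?_⟩
  rw [measurableEmbedding_inl.ae_map_iff]
  filter_upwards [ae_exitMeasure (P := P) hA ((h.ae_ae hc).mono fun x hx _ => hx),
    h.ae_exit_cemetery hA h0 h1] with x hx hx0
  rw [← lintegral_elim_extendZero f hx0, lintegral_exitKernel hA _ hfe]
  exact lintegral_condKernel_const hA hx.1 hx.2

end Exit

/-! ### Domination of potentials by excessive functions -/

section Potential

variable {X : Type*} [MeasurableSpace X] {κ : Kernel X X}

/-- The potential of `w` is at most any `f ≥ 0` with `f ≥ w + κ f`. -/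
theorem lintegral_green_le {w f : X → ℝ≥0∞} (hw : Measurable w)
    (h : ∀ x, w x + ∫⁻ y, f y ∂(κ x) ≤ f x) (x : X) :
    ∫⁻ y, w y ∂(greenKernel κ x) ≤ f x := by
  rw [lintegral_green]
  refine ENNReal.tsum_le_of_sum_range_le fun n => ?_
  induction n generalizing x with
  | zero => simp
  | succ n ih =>
    rw [Finset.sum_range_succ', lintegral_pow_zero _ _ hw, add_comm]
    refine le_trans (add_le_add_right ?_ _) (h x)
    simp_rw [lintegral_pow_succ _ _ _ hw]
    rw [← lintegral_finsetSum _ fun i _ => hw.lintegral_kernel]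
    exact lintegral_mono ih

end Potential

/-! ### Continuous excessive functions of a recurrent walk -/

section Group

variable {G : Type*} [AddCommGroup G] [TopologicalSpace G] [IsTopologicalAddGroup G]
  [MeasurableSpace G] [BorelSpace G] [SecondCountableTopology G]

/-- The transition kernel `x ↦ law of x + ξ`, where `ξ` has law `p`. -/
def translationKernel (p : Measure G) [SFinite p] : Kernel G G where
  toFun x := p.map fun y => x + y
  measurable' := by
    refine Measure.measurable_of_measurable_coe _ fun s hs => ?_
    have h : Measurable fun q : G × G => q.1 + q.2 := measurable_add
    have h2 := measurable_measure_prodMk_left (ν := p) (h hs)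
    have h3 : (fun x => p.map (fun y => x + y) s) =
        fun x => p (Prod.mk x ⁻¹' ((fun q => q.1 + q.2) ⁻¹' s)) := by
      funext x
      rw [Measure.map_apply (measurable_const_add x) hs]
      rfl
    rw [h3]
    exact h2

variable (p : Measure G) [IsProbabilityMeasure p]

instance : IsMarkovKernel (translationKernel p) :=
  ⟨fun x => Measure.isProbabilityMeasure_map (measurable_const_add x).aemeasurable⟩

theorem lintegral_translationKernel (x : G) {f : G → ℝ≥0∞} (hf : Measurable f) :
    ∫⁻ y, f y ∂(translationKernel p x) = ∫⁻ s, f (x + s) ∂p :=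
  lintegral_map hf (measurable_const_add x)

theorem lintegral_translationKernel_pow (n : ℕ) (a x : G) {f : G → ℝ≥0∞} (hf : Measurable f) :
    ∫⁻ y, f y ∂((translationKernel p ^ n) (a + x)) =
      ∫⁻ y, f (a + y) ∂((translationKernel p ^ n) x) := by
  have hfa : Measurable fun y => f (a + y) := hf.comp (measurable_const_add a)
  induction n generalizing x with
  | zero => rw [lintegral_pow_zero _ _ hf, lintegral_pow_zero _ _ hfa]
  | succ n ih =>
    rw [lintegral_pow_succ _ _ _ hf, lintegral_pow_succ _ _ _ hfa,
      lintegral_translationKernel _ _ hf.lintegral_kernel,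
      lintegral_translationKernel _ _ hfa.lintegral_kernel]
    refine lintegral_congr fun s => ?_
    rw [add_assoc, ih]

theorem translationKernel_pow_add (n : ℕ) (a x : G) {U : Set G} (hU : MeasurableSet U) :
    (translationKernel p ^ n) (a + x) U = (translationKernel p ^ n) x ((a + ·) ⁻¹' U) := by
  have := lintegral_translationKernel_pow p n a x (measurable_one.indicator hU)
  rw [lintegral_indicator_one hU] at this
  rw [this, ← lintegral_indicator_one (measurable_const_add a hU)]
  rfl

theorem green_translationKernel_add (a x : G) {U : Set G} (hU : MeasurableSet U) :
    greenKernel (translationKernel p) (a + x) U =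
      greenKernel (translationKernel p) x ((a + ·) ⁻¹' U) := by
  rw [greenKernel, Kernel.sum_apply' _ _ hU, Kernel.sum_apply' _ _ (measurable_const_add a hU)]
  simp_rw [translationKernel_pow_add p _ a x hU]

/-- The random walk with step distribution `p` spends infinite expected time in each neighbourhood
of its starting point, and does not live on a proper closed subgroup. -/
structure IsRecurrentStep : Prop where
  green : ∀ V : Set G, IsOpen V → 0 ∈ V → greenKernel (translationKernel p) 0 V = ∞
  generates : ∀ H : AddSubgroup G, IsClosed (H : Set G) → (∀ᵐ s ∂p, s ∈ H) → H = ⊤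

variable {p}

theorem continuous_lintegral_add {g : G → ℝ≥0} (hg : Continuous g) {c : ℝ≥0} (hc : ∀ x, g x ≤ c) :
    Continuous fun x => ∫ s, (g (x + s) : ℝ) ∂p := by
  refine continuous_of_dominated (bound := fun _ => c) ?_ ?_ (integrable_const _) ?_
  · intro x
    exact (NNReal.continuous_coe.comp (hg.comp (continuous_const.add continuous_id))).measurable
      |>.aestronglyMeasurable
  · intro x
    refine Filter.Eventually.of_forall fun s => ?_
    simpa using hc (x + s)
  · refine Filter.Eventually.of_forall fun s => ?_
    exact NNReal.continuous_coe.comp (hg.comp (continuous_id.add continuous_const))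

theorem integrable_add {g : G → ℝ≥0} (hg : Continuous g) {c : ℝ≥0} (hc : ∀ x, g x ≤ c) (x : G) :
    Integrable (fun s => (g (x + s) : ℝ)) p := by
  refine Integrable.of_bound (C := c)
    ((NNReal.continuous_coe.comp (hg.comp (continuous_const.add continuous_id))).measurable
      |>.aestronglyMeasurable)
    (Filter.Eventually.of_forall fun s => ?_)
  simpa using hc (x + s)

/-- Bounded continuous excessive functions of a recurrent walk are harmonic. -/
theorem IsRecurrentStep.harmonic (hp : IsRecurrentStep p) {g : G → ℝ≥0} (hg : Continuous g)
    {c : ℝ≥0} (hc : ∀ x, g x ≤ c) (hle : ∀ x, ∫ s, (g (x + s) : ℝ) ∂p ≤ g x) (x : G) :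
    ∫ s, (g (x + s) : ℝ) ∂p = g x := by
  by_contra hne
  set D : G → ℝ := fun x => g x - ∫ s, (g (x + s) : ℝ) ∂p with hD
  have hDc : Continuous D :=
    (NNReal.continuous_coe.comp hg).sub (continuous_lintegral_add hg hc)
  have hDx : 0 < D x := sub_pos.2 (lt_of_le_of_ne (hle x) hne)
  set V : Set G := {y | D x / 2 < D y} with hV
  have hVo : IsOpen V := isOpen_lt continuous_const hDc
  have hgm : Measurable fun y => (g y : ℝ≥0∞) := hg.measurable.coe_nnreal_ennreal
  -- The potential of the defect D = g - Pg is at most the finite g(x). But D stays above D(x)/2 on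
  -- an open set containing x, whose Green measure from x is infinite.
  have hfin : ∫⁻ y, ENNReal.ofReal (D y) ∂(greenKernel (translationKernel p) x) ≤ g x := by
    refine lintegral_green_le (f := fun y => (g y : ℝ≥0∞)) hDc.measurable.ennreal_ofReal
      (fun y => ?_) x
    rw [lintegral_translationKernel p y hgm]
    have h1 : ∫⁻ s, (g (y + s) : ℝ≥0∞) ∂p = ENNReal.ofReal (∫ s, (g (y + s) : ℝ) ∂p) := by
      rw [ofReal_integral_eq_lintegral_ofReal (integrable_add hg hc y)
        (Filter.Eventually.of_forall fun s => NNReal.coe_nonneg _)]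
      simp
    rw [h1, ← ENNReal.ofReal_add (sub_nonneg.2 (hle y))
      (integral_nonneg fun s => NNReal.coe_nonneg _)]
    simp
  have hinf : greenKernel (translationKernel p) x V = ∞ := by
    have := green_translationKernel_add p x 0 hVo.measurableSet
    rw [add_zero] at this
    rw [this]
    refine hp.green _ (hVo.preimage (continuous_const.add continuous_id)) ?_
    simp only [mem_preimage, add_zero, hV, mem_ofPred_eq]
    linarith
  have h2 : ∫⁻ _ in V, ENNReal.ofReal (D x / 2) ∂(greenKernel (translationKernel p) x) ≤ g x := by
    refine le_trans ?_ hfin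
    refine le_trans (setLIntegral_mono hDc.measurable.ennreal_ofReal fun y hy => ?_)
      (setLIntegral_le_lintegral _ _)
    exact ENNReal.ofReal_le_ofReal (le_of_lt hy)
  rw [setLIntegral_const, hinf, ENNReal.mul_top (by simpa using hDx)] at h2
  exact absurd h2 (by simp)

/-- Bounded continuous excessive functions of a recurrent walk are constant. -/
theorem IsRecurrentStep.const_of_bounded (hp : IsRecurrentStep p) {g : G → ℝ≥0}
    (hg : Continuous g) {c : ℝ≥0} (hc : ∀ x, g x ≤ c)
    (hle : ∀ x, ∫ s, (g (x + s) : ℝ) ∂p ≤ g x) (x : G) : g x = g 0 := by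
  have hharm := hp.harmonic hg hc hle
  have hsq : ∀ x, Integrable (fun s => (g (x + s) : ℝ) ^ 2) p := fun x => by
    have h := integrable_add (p := p) (g := fun y => g y ^ 2) (hg.pow 2) (c := c ^ 2)
      (fun y => pow_le_pow_left' (hc y) 2) x
    simpa using h
  have hvar : ∀ x, ∫ s, ((g (x + s) : ℝ) - g x) ^ 2 ∂p = ∫ s, (g (x + s) : ℝ) ^ 2 ∂p - g x ^ 2 := by
    intro x
    have h1 : ∀ s, ((g (x + s) : ℝ) - g x) ^ 2 =
        (g (x + s) : ℝ) ^ 2 - 2 * g x * g (x + s) + g x ^ 2 := fun s => by ring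
    have hi : Integrable (fun s => (g (x + s) : ℝ) ^ 2 - 2 * g x * g (x + s)) p :=
      (hsq x).sub ((integrable_add hg hc x).const_mul _)
    simp_rw [h1]
    rw [integral_add hi (integrable_const _),
      integral_sub (hsq x) ((integrable_add hg hc x).const_mul _), integral_const_mul, hharm]
    simp
    ring
  -- The variance identity shows that c² - g² is excessive, hence harmonic as well, so the variance
  -- of g along one step vanishes.
  have hk : ∀ x, ∫ s, (g (x + s) : ℝ) ^ 2 ∂p = g x ^ 2 := by
    have hsub : ∀ y, ((c ^ 2 - g y ^ 2 : ℝ≥0) : ℝ) = c ^ 2 - (g y : ℝ) ^ 2 := fun y => by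
      rw [NNReal.coe_sub (pow_le_pow_left' (hc y) 2)]; simp
    have hint : ∀ x, ∫ s, ((c ^ 2 - g (x + s) ^ 2 : ℝ≥0) : ℝ) ∂p =
        c ^ 2 - ∫ s, (g (x + s) : ℝ) ^ 2 ∂p := by
      intro x
      simp_rw [hsub]
      rw [integral_sub (integrable_const _) (hsq x)]
      simp
    intro x
    have := hp.harmonic (g := fun y => c ^ 2 - g y ^ 2) (c := c ^ 2)
      (continuous_const.sub (hg.pow 2)) (fun y => tsub_le_self) (fun y => by
        rw [hint, hsub]
        have h0 : 0 ≤ ∫ s, ((g (y + s) : ℝ) - g y) ^ 2 ∂p :=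
          integral_nonneg fun s => sq_nonneg _
        rw [hvar] at h0
        linarith) x
    rw [hint, hsub] at this
    linarith
  have hae : ∀ x, ∀ᵐ s ∂p, g (x + s) = g x := by
    intro x
    have h0 : ∫ s, ((g (x + s) : ℝ) - g x) ^ 2 ∂p = 0 := by rw [hvar, hk]; ring
    have hi : Integrable (fun s => ((g (x + s) : ℝ) - g x) ^ 2) p := by
      have h1 : (fun s => ((g (x + s) : ℝ) - g x) ^ 2) =
          fun s => (g (x + s) : ℝ) ^ 2 - 2 * g x * g (x + s) + g x ^ 2 := by
        funext s; ring
      rw [h1]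
      exact ((hsq x).sub ((integrable_add hg hc x).const_mul _)).add (integrable_const _)
    rw [integral_eq_zero_iff_of_nonneg (fun s => sq_nonneg _) hi] at h0
    filter_upwards [h0] with s hs
    have hs' : ((g (x + s) : ℝ) - g x) ^ 2 = 0 := hs
    exact NNReal.coe_injective (sub_eq_zero.1 (pow_eq_zero_iff (by norm_num) |>.1 hs'))
  -- This is the group of periods of `g`, closed by continuity.
  let H : AddSubgroup G :=
    { carrier := {s | ∀ x, g (x + s) = g x}
      zero_mem' := fun x => by rw [add_zero]
      add_mem' := fun {a b} ha hb x => by rw [← add_assoc, hb, ha]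
      neg_mem' := fun {a} ha x => by
        have := ha (x + -a)
        rw [neg_add_cancel_right] at this
        exact this.symm }
  have hHc : IsClosed (H : Set G) := by
    have : (H : Set G) = ⋂ x, {s | g (x + s) = g x} := by
      ext s
      simp only [mem_iInter]
      rfl
    rw [this]
    exact isClosed_iInter fun x =>
      isClosed_eq (hg.comp (continuous_const.add continuous_id)) continuous_const
  have hHp : ∀ᵐ s ∂p, s ∈ H := by
    -- The exceptional null set depends on the base point, so only a countable dense set of base
    -- points is used; continuity supplies the rest.
    filter_upwards [ae_all_iff.2 fun n => hae (TopologicalSpace.denseSeq G n)] with s hs x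
    have := (TopologicalSpace.denseRange_denseSeq G).equalizer
      (hg.comp (continuous_id.add continuous_const)) hg (funext hs)
    exact congrFun this x
  have := hp.generates H hHc hHp
  have hx : x ∈ H := this ▸ AddSubgroup.mem_top x
  simpa using hx 0

end Group

/-! ### Excessive measures, duality and the Liouville property of the walk -/

section Group

open scoped Topology CompactlySupported

variable {G : Type*} [AddCommGroup G] [TopologicalSpace G] [IsTopologicalAddGroup G]
  [MeasurableSpace G] [BorelSpace G] [SecondCountableTopology G] [LocallyCompactSpace G]
  [T2Space G] {p : Measure G} [IsProbabilityMeasure p]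

/-- Excessive measures of a recurrent walk are translation invariant. -/
theorem IsRecurrentStep.isAddLeftInvariant (hp : IsRecurrentStep p) (m : Measure G)
    [IsFiniteMeasureOnCompacts m] (hm : m.bind (translationKernel p) ≤ m) :
    m.IsAddLeftInvariant := by
  have key : ∀ (φ : C_c(G, ℝ≥0)) (x : G), ∫ y, (φ (x + y) : ℝ) ∂m = ∫ y, (φ y : ℝ) ∂m := by
    intro φ
    have hφc : Continuous fun y => (φ y : ℝ) := NNReal.continuous_coe.comp φ.continuous
    have hφs : HasCompactSupport fun y => (φ y : ℝ) :=
      φ.hasCompactSupport.comp_left (g := ((↑) : ℝ≥0 → ℝ)) rfl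
    have hφE : Measurable fun y => (φ y : ℝ≥0∞) :=
      φ.continuous.measurable.coe_nnreal_ennreal
    have hint : ∀ x, Integrable (fun y => (φ (x + y) : ℝ)) m := fun x =>
      (hφc.comp (continuous_const.add continuous_id)).integrable_of_hasCompactSupport
        (hφs.comp_homeomorph (Homeomorph.addLeft x))
    have hGc : Continuous fun x => ∫ y, (φ (x + y) : ℝ) ∂m := by
      have h1 : Continuous fun x => ∫ y, (φ (-(-y + x)) : ℝ) ∂m :=
        continuous_integral_apply_neg_add (g := fun z => (φ (-z) : ℝ))
          (hφc.comp continuous_neg) (hφs.comp_homeomorph (Homeomorph.neg G))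
      have h2 := h1.comp continuous_neg
      refine h2.congr fun x => integral_congr_ae (Filter.Eventually.of_forall fun y => ?_)
      simp [add_comm]
    set g : G → ℝ≥0 := fun x => (∫ y, (φ (x + y) : ℝ) ∂m).toNNReal with hg
    have hgc : Continuous g := continuous_real_toNNReal.comp hGc
    have hgE : ∀ x, (g x : ℝ≥0∞) = ∫⁻ y, (φ (x + y) : ℝ≥0∞) ∂m := by
      intro x
      change ENNReal.ofReal _ = _
      rw [ofReal_integral_eq_lintegral_ofReal (hint x)
        (Filter.Eventually.of_forall fun y => NNReal.coe_nonneg _)]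
      simp
    have hgle : ∀ x, ∫⁻ s, (g (x + s) : ℝ≥0∞) ∂p ≤ g x := by
      intro x
      simp_rw [hgE]
      have hφx : Measurable fun y => (φ (x + y) : ℝ≥0∞) := hφE.comp (measurable_const_add x)
      calc ∫⁻ s, ∫⁻ y, (φ (x + s + y) : ℝ≥0∞) ∂m ∂p
          = ∫⁻ y, ∫⁻ s, (φ (x + s + y) : ℝ≥0∞) ∂p ∂m := by
            refine lintegral_lintegral_swap (Measurable.aemeasurable ?_)
            exact hφE.comp ((measurable_fst.const_add x).add measurable_snd)
        _ = ∫⁻ y, (φ (x + y) : ℝ≥0∞) ∂(m.bind (translationKernel p)) := by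
            rw [lintegral_bind_kernel _ _ hφx]
            refine lintegral_congr fun y => ?_
            rw [lintegral_translationKernel p y hφx]
            refine lintegral_congr fun s => ?_
            rw [add_assoc, add_comm s y]
        _ ≤ _ := lintegral_mono' hm le_rfl
    have hconst : ∀ x, g x = g 0 := by
      intro x
      -- `g` need not be bounded. Its truncation at a level above both values to be compared is
      -- still excessive and leaves these values unchanged.
      set c := max (g x) (g 0)
      have h := hp.const_of_bounded (g := fun y => min (g y) c) (hgc.min continuous_const)
        (fun y => min_le_right _ _) (fun y => ?_) x
      · rwa [min_eq_left (le_max_left _ _), min_eq_left (le_max_right _ _)] at h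
      · have hmc : Continuous fun y => min (g y) c := hgc.min continuous_const
        have e : ∫⁻ s, ((min (g (y + s)) c : ℝ≥0) : ℝ≥0∞) ∂p ≤ ((min (g y) c : ℝ≥0) : ℝ≥0∞) := by
          rw [ENNReal.coe_min]
          refine le_min ?_ ?_
          · refine le_trans (lintegral_mono fun s => ?_) (hgle y)
            exact ENNReal.coe_le_coe.2 (min_le_left _ _)
          · refine le_trans (lintegral_mono fun s => ENNReal.coe_le_coe.2 (min_le_right _ c)) ?_
            simp
        have e2 : ENNReal.ofReal (∫ s, ((min (g (y + s)) c : ℝ≥0) : ℝ) ∂p) ≤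
            ((min (g y) c : ℝ≥0) : ℝ≥0∞) := by
          rw [ofReal_integral_eq_lintegral_ofReal
            (integrable_add hmc (fun y => min_le_right _ _) y)
            (Filter.Eventually.of_forall fun s => NNReal.coe_nonneg _)]
          simpa only [ENNReal.ofReal_coe_nnreal] using e
        rwa [← ENNReal.ofReal_coe_nnreal, ENNReal.ofReal_le_ofReal_iff (NNReal.coe_nonneg _)] at e2
    intro x
    have h1 : ∀ x, 0 ≤ ∫ y, (φ (x + y) : ℝ) ∂m := fun x =>
      integral_nonneg fun y => NNReal.coe_nonneg _
    have h2 := (Real.toNNReal_eq_toNNReal_iff (h1 x) (h1 0)).1 (hconst x)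
    simpa using h2
  refine ⟨fun x => ?_⟩
  have hfin : IsFiniteMeasureOnCompacts (m.map (x + ·)) := by
    refine ⟨fun K hK => ?_⟩
    rw [Measure.map_apply (measurable_const_add x) hK.measurableSet]
    exact ((Homeomorph.addLeft x).isCompact_preimage.2 hK).measure_lt_top
  refine Measure.ext_of_integral_eq_on_compactlySupported_nnreal fun φ => ?_
  rw [integral_map (f := fun y => (φ y : ℝ)) (measurable_const_add x).aemeasurable
    (NNReal.continuous_coe.comp φ.continuous).measurable.aestronglyMeasurable]
  exact key φ x

/-- Excessive measures of a recurrent walk are multiples of the Haar measure. -/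
theorem IsRecurrentStep.eq_smul (hp : IsRecurrentStep p) (μ : Measure G) [μ.IsAddHaarMeasure]
    (m : Measure G) [IsFiniteMeasureOnCompacts m] (hm : m.bind (translationKernel p) ≤ m) :
    ∃ c : ℝ≥0, m = c • μ := by
  have := hp.isAddLeftInvariant m hm
  exact ⟨_, Measure.isAddLeftInvariant_eq_smul m μ⟩

/-- Reflection y ↦ -y conjugates the reversed walk to the original one. -/
theorem lintegral_pow_map_neg (n : ℕ) (x : G) {f : G → ℝ≥0∞} (hf : Measurable f) :
    ∫⁻ y, f y ∂((translationKernel (p.map Neg.neg) ^ n) x) =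
      ∫⁻ y, f (-y) ∂((translationKernel p ^ n) (-x)) := by
  have := Measure.isProbabilityMeasure_map (μ := p) (measurable_neg (G := G)).aemeasurable
  have hfn : Measurable fun y => f (-y) := hf.comp measurable_neg
  induction n generalizing x with
  | zero => rw [lintegral_pow_zero _ _ hf, lintegral_pow_zero _ _ hfn, neg_neg]
  | succ n ih =>
    rw [lintegral_pow_succ _ _ _ hf, lintegral_pow_succ _ _ _ hfn,
      lintegral_translationKernel _ _ hf.lintegral_kernel,
      lintegral_translationKernel _ _ hfn.lintegral_kernel,
      lintegral_map (f := fun s => ∫⁻ b, f b ∂((translationKernel (p.map Neg.neg) ^ n) (x + s)))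
        (hf.lintegral_kernel.comp (measurable_const_add x)) measurable_neg]
    refine lintegral_congr fun s => ?_
    rw [ih, neg_add, neg_neg]

instance : IsProbabilityMeasure (p.map Neg.neg) :=
  Measure.isProbabilityMeasure_map measurable_neg.aemeasurable

theorem IsRecurrentStep.neg (hp : IsRecurrentStep p) : IsRecurrentStep (p.map Neg.neg) := by
  constructor
  · intro V hV h0
    have hVn : IsOpen (Neg.neg ⁻¹' V) := hV.preimage continuous_neg
    rw [← hp.green _ hVn (by simpa using h0), greenKernel, greenKernel,
      Kernel.sum_apply' _ _ hV.measurableSet, Kernel.sum_apply' _ _ hVn.measurableSet]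
    refine tsum_congr fun n => ?_
    have := lintegral_pow_map_neg (p := p) n 0 (measurable_one.indicator hV.measurableSet)
    rw [lintegral_indicator_one hV.measurableSet, neg_zero] at this
    rw [this, ← lintegral_indicator_one hVn.measurableSet]
    rfl
  · intro H hH hHp
    refine hp.generates H hH ?_
    have := ae_of_ae_map measurable_neg.aemeasurable hHp
    exact this.mono fun s hs => neg_mem_iff.1 hs

variable (μ : Measure G) [μ.IsAddHaarMeasure]

theorem bind_translationKernel (p : Measure G) [IsProbabilityMeasure p] :
    μ.bind (translationKernel p) = μ := by
  refine Measure.ext_of_lintegral _ fun f hf => ?_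
  rw [lintegral_bind_kernel _ _ hf]
  simp_rw [lintegral_translationKernel p _ hf]
  rw [lintegral_lintegral_swap (f := fun x s => f (x + s))
    (hf.comp (measurable_fst.add measurable_snd)).aemeasurable]
  simp_rw [lintegral_add_right_eq_self (μ := μ) f]
  simp

theorem isFiniteMeasureOnCompacts_of_le {m : Measure G} (h : m ≤ μ) :
    IsFiniteMeasureOnCompacts m :=
  ⟨fun _ hK => (h _).trans_lt hK.measure_lt_top⟩

/-- The measure statement is uniqueness of excessive measures. For an excessive function F, Haar
invariance moves the step from F to the test function, so that Fμ is excessive for the reversed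
walk, which is recurrent too; hence Fμ = cμ and F = c a.e. -/
theorem IsRecurrentStep.isLiouville (hp : IsRecurrentStep p) :
    IsLiouville (translationKernel p) μ := by
  refine ⟨bind_translationKernel μ p, ?_, ?_⟩
  · intro F hF hF1 hle
    have hle' : μ.withDensity F ≤ μ := by
      conv_rhs => rw [← withDensity_one (μ := μ)]
      exact withDensity_mono (Filter.Eventually.of_forall hF1)
    have := isFiniteMeasureOnCompacts_of_le μ hle'
    obtain ⟨c, hc⟩ := hp.neg.eq_smul μ (μ.withDensity F) (by
      refine Measure.le_iff.2 fun s hs => ?_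
      have hi : Measurable (s.indicator (1 : G → ℝ≥0∞)) := measurable_one.indicator hs
      rw [← lintegral_indicator_one hs, ← lintegral_indicator_one hs, lintegral_bind_kernel _ _ hi,
        lintegral_withDensity_eq_lintegral_mul _ hF hi.lintegral_kernel,
        lintegral_withDensity_eq_lintegral_mul _ hF hi]
      calc ∫⁻ y, F y * ∫⁻ z, s.indicator 1 z ∂(translationKernel (p.map Neg.neg) y) ∂μ
          = ∫⁻ y, ∫⁻ t, F y * s.indicator 1 (y - t) ∂p ∂μ := by
            refine lintegral_congr fun y => ?_
            rw [lintegral_translationKernel _ _ hi,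
              lintegral_map (f := fun t => s.indicator (1 : G → ℝ≥0∞) (y + t))
                (hi.comp (measurable_const_add y)) measurable_neg,
              lintegral_const_mul (f := fun t => s.indicator (1 : G → ℝ≥0∞) (y - t)) _
                (hi.comp (measurable_const.sub measurable_id))]
            simp_rw [sub_eq_add_neg]
        _ = ∫⁻ t, ∫⁻ y, F y * s.indicator 1 (y - t) ∂μ ∂p := by
            refine lintegral_lintegral_swap (Measurable.aemeasurable ?_)
            exact (hF.comp measurable_fst).mul (hi.comp (measurable_fst.sub measurable_snd))
        _ = ∫⁻ t, ∫⁻ y, F (y + t) * s.indicator 1 y ∂μ ∂p := by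
            refine lintegral_congr fun t => ?_
            rw [← lintegral_add_right_eq_self (μ := μ) _ t]
            simp_rw [add_sub_cancel_right]
        _ = ∫⁻ y, ∫⁻ t, F (y + t) * s.indicator 1 y ∂p ∂μ := by
            refine lintegral_lintegral_swap (Measurable.aemeasurable ?_)
            exact (hF.comp (measurable_snd.add measurable_fst)).mul (hi.comp measurable_snd)
        _ ≤ ∫⁻ y, F y * s.indicator 1 y ∂μ := by
            refine lintegral_mono fun y => ?_
            dsimp only
            rw [lintegral_mul_const (f := fun t => F (y + t)) _ (hF.comp (measurable_const_add y)),
              ← lintegral_translationKernel p y hF]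
            gcongr
            exact hle y)
    refine ⟨c, ?_⟩
    have hc' : μ.withDensity F = μ.withDensity fun _ => (c : ℝ≥0∞) := by
      rw [hc, withDensity_const]; rfl
    exact (withDensity_eq_iff_of_sigmaFinite hF.aemeasurable aemeasurable_const).1 hc'
  · intro m hm hmP
    have := isFiniteMeasureOnCompacts_of_le μ hm
    obtain ⟨c, hc⟩ := hp.eq_smul μ m hmP
    exact ⟨c, hc⟩

/-! ### Irreducibility and uniqueness of invariant measures -/

/-- A recurrent walk reaches every nonempty open set from every starting point. -/
theorem IsRecurrentStep.exists_pow_pos (hp : IsRecurrentStep p) (μ : Measure G)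
    [μ.IsAddHaarMeasure] {U : Set G} (hU : IsOpen U) (hne : U.Nonempty) (x : G) :
    ∃ n, (translationKernel p ^ n) x U ≠ 0 := by
  set κ := translationKernel p with hκ
  obtain ⟨u, hu⟩ := hne
  obtain ⟨U', W, hU', hW, huU', hW0, hsub⟩ :
      ∃ U' W : Set G, IsOpen U' ∧ IsOpen W ∧ u ∈ U' ∧ (0 : G) ∈ W ∧ U' ×ˢ W ⊆
        (fun q : G × G => q.1 + q.2) ⁻¹' U :=
    isOpen_prod_iff.1 (hU.preimage continuous_add) u 0 (by simpa using hu)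
  -- A walk outside `D` almost surely does not enter `D` in one step, so the indicator of `D` is
  -- excessive and a.e. constant; the constant is 1 since `D` contains `U'`. An arbitrary `x` is
  -- then replaced by a nearby point of `D`, the displacement being absorbed by `W` because U' + W ⊆
  -- U.
  set D : Set G := {y | greenKernel κ y U' ≠ 0} with hD
  have hgm : Measurable fun y => greenKernel κ y U' := Kernel.measurable_coe _ hU'.measurableSet
  have hDm : MeasurableSet D := (hgm (measurableSet_singleton 0)).compl
  have hstep : ∀ y, greenKernel κ y U' =
      U'.indicator 1 y + ∫⁻ z, greenKernel κ z U' ∂(κ y) := by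
    intro y
    have := lintegral_green_eq_add κ y (measurable_one.indicator hU'.measurableSet)
    simpa only [lintegral_indicator_one hU'.measurableSet] using this
  obtain ⟨c, hc⟩ := (hp.isLiouville μ).function_const (D.indicator 1) (measurable_one.indicator hDm)
    (fun y => indicator_le_self' (fun _ _ => zero_le) y) (fun y => by
      by_cases hy : y ∈ D
      · rw [indicator_of_mem hy, lintegral_indicator_one hDm]
        exact prob_le_one
      · rw [lintegral_indicator_one hDm, indicator_of_notMem hy]
        have h0 : greenKernel κ y U' = 0 := not_not.1 hy
        rw [hstep y, add_eq_zero, lintegral_eq_zero_iff hgm] at h0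
        refine le_of_eq (measure_eq_zero_iff_ae_notMem.2 ?_)
        exact h0.2.mono fun z hz hzD => hzD hz)
  have hcU : c = 1 := by
    have hpos : μ U' ≠ 0 := (hU'.measure_pos μ ⟨u, huU'⟩).ne'
    obtain ⟨y, hyU, hyc⟩ := ((frequently_ae_mem_iff.2 hpos).and_eventually hc).exists
    have hyD : y ∈ D := by
      change greenKernel κ y U' ≠ 0
      rw [hstep y, indicator_of_mem hyU]
      simp
    rw [← hyc, indicator_of_mem hyD]; rfl
  have hxW : IsOpen {y | x - y ∈ W} := hW.preimage (continuous_const.sub continuous_id)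
  have hpos : μ {y | x - y ∈ W} ≠ 0 := (hxW.measure_pos μ ⟨x, by simpa using hW0⟩).ne'
  obtain ⟨y, hyW, hyc⟩ := ((frequently_ae_mem_iff.2 hpos).and_eventually hc).exists
  have hyD : greenKernel κ y U' ≠ 0 := by
    by_contra hcon
    have : y ∉ D := fun h => h hcon
    rw [indicator_of_notMem this, hcU] at hyc
    exact zero_ne_one hyc
  rw [greenKernel, Kernel.sum_apply' _ _ hU'.measurableSet] at hyD
  obtain ⟨n, hn⟩ : ∃ n, (κ ^ n) y U' ≠ 0 := by
    by_contra! hcon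
    exact hyD (by simp [hcon])
  refine ⟨n, fun h0 => hn (le_antisymm ?_ zero_le)⟩
  have := translationKernel_pow_add p n (x - y) y hU.measurableSet
  rw [sub_add_cancel] at this
  rw [← h0, this]
  refine measure_mono fun z hz => ?_
  have : (z, x - y) ∈ U' ×ˢ W := ⟨hz, hyW⟩
  rw [mem_preimage, add_comm]
  exact hsub this

/-- If a nonempty open set is charged by the `n`-step transition from `x`, then a larger set is
charged uniformly from the points near `x`. -/
theorem translationKernel_pow_le_of_near (p : Measure G) [IsProbabilityMeasure p] (n : ℕ)
    {U U' W : Set G} (hU : MeasurableSet U)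
    (hsub : U' ×ˢ W ⊆ (fun q : G × G => q.1 + q.2) ⁻¹' U) {x y : G} (hy : y - x ∈ W) :
    (translationKernel p ^ n) x U' ≤ (translationKernel p ^ n) y U := by
  have := translationKernel_pow_add p n (y - x) x hU
  rw [sub_add_cancel] at this
  rw [this]
  refine measure_mono fun z hz => ?_
  rw [mem_preimage, add_comm]
  exact hsub (show (z, y - x) ∈ U' ×ˢ W from ⟨hz, hy⟩)

theorem bind_pow_eq {X : Type*} [MeasurableSpace X] {κ : Kernel X X} {m : Measure X}
    (h : m.bind κ = m) (n : ℕ) {f : X → ℝ≥0∞} (hf : Measurable f) :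
    ∫⁻ x, ∫⁻ y, f y ∂((κ ^ n) x) ∂m = ∫⁻ x, f x ∂m := by
  induction n with
  | zero => simp_rw [lintegral_pow_zero κ _ hf]
  | succ n ih =>
    simp_rw [lintegral_pow_succ κ _ _ hf]
    rw [← lintegral_bind_kernel _ _ hf.lintegral_kernel, h, ih]

/-- An invariant measure of a recurrent walk which is finite on some nonempty open set is a multiple
of the Haar measure. -/
theorem IsRecurrentStep.eq_smul_of_open (hp : IsRecurrentStep p) {m : Measure G}
    (hm : m.bind (translationKernel p) = m) {U : Set G} (hU : IsOpen U) (hne : U.Nonempty)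
    (hfin : m U < ∞) : ∃ c : ℝ≥0, m = c • μ := by
  have hloc : IsLocallyFiniteMeasure m := by
    refine ⟨fun x => ?_⟩
    obtain ⟨u, hu⟩ := hne
    obtain ⟨U', W, hU', hW, huU', hW0, hsub⟩ :
        ∃ U' W : Set G, IsOpen U' ∧ IsOpen W ∧ u ∈ U' ∧ (0 : G) ∈ W ∧ U' ×ˢ W ⊆
          (fun q : G × G => q.1 + q.2) ⁻¹' U :=
      isOpen_prod_iff.1 (hU.preimage continuous_add) u 0 (by simpa using hu)
    obtain ⟨n, hn⟩ := hp.exists_pow_pos μ hU' ⟨u, huU'⟩ x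
    set ε := (translationKernel p ^ n) x U' with hε
    have hV : IsOpen {y | y - x ∈ W} := hW.preimage (continuous_id.sub continuous_const)
    refine ⟨{y | y - x ∈ W}, hV.mem_nhds (by simpa using hW0), ?_⟩
    -- From every point near `x` the walk is in `U` after `n` steps with probability at least ε > 0,
    -- while invariance bounds the total mass arriving in `U` by m(U).
    have h1 : ε * m {y | y - x ∈ W} ≤ m U := by
      calc ε * m {y | y - x ∈ W} = ∫⁻ _ in {y | y - x ∈ W}, ε ∂m := by rw [setLIntegral_const]
        _ ≤ ∫⁻ y in {y | y - x ∈ W}, (translationKernel p ^ n) y U ∂m :=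
            setLIntegral_mono (Kernel.measurable_coe _ hU.measurableSet) fun y hy =>
              translationKernel_pow_le_of_near p n hU.measurableSet hsub hy
        _ ≤ ∫⁻ y, (translationKernel p ^ n) y U ∂m := setLIntegral_le_lintegral _ _
        _ = m U := by
            have := bind_pow_eq hm n (measurable_one.indicator hU.measurableSet)
            simpa only [lintegral_indicator_one hU.measurableSet] using this
    by_contra hcon
    rw [not_lt, top_le_iff] at hcon
    rw [hcon, ENNReal.mul_top hn, top_le_iff] at h1
    exact hfin.ne h1
  exact hp.eq_smul μ m hm.le

/-- An invariant measure of a recurrent walk is a multiple of the Haar measure if the induced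
measure on the crossings from `Aᶜ` to `A` is locally finite. -/
theorem IsRecurrentStep.eq_smul_of_crossing (hp : IsRecurrentStep p) {A : Set G}
    (hA : MeasurableSet A) (h0 : μ A ≠ 0) (h1 : μ Aᶜ ≠ 0) (hbd : μ (frontier A) = 0)
    {m : Measure G} (hm : m.bind (translationKernel p) = m)
    (hfin : ∀ x ∉ A, ∀ w ∈ A, ∃ O₁ O₂ : Set G, IsOpen O₁ ∧ IsOpen O₂ ∧ x ∈ O₁ ∧ w ∈ O₂ ∧
      ∫⁻ y in O₁ ∩ Aᶜ, translationKernel p y (O₂ ∩ A) ∂m < ∞) :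
    ∃ c : ℝ≥0, m = c • μ := by
  set κ := translationKernel p with hκ
  have hL := hp.isLiouville μ
  -- Since the frontier is null, a.e. point and a.e. landing point avoid it. If no jump led from one
  -- interior to the other, there would be a.e. no crossings at all.
  obtain ⟨x, hxA, hx⟩ : ∃ x ∈ interior Aᶜ, κ x (interior A) ≠ 0 := by
    by_contra! hcon
    refine hL.bind_crossKernel_ne_zero hA h0 h1 (Measure.measure_univ_eq_zero.1 ?_)
    rw [Measure.bind_apply MeasurableSet.univ (Kernel.measurable _).aemeasurable,
      lintegral_eq_zero_iff (measurable_crossKernel_univ κ hA)]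
    have hbd' := measure_eq_zero_iff_ae_notMem.1 hbd
    filter_upwards [hbd', hL.ae_ae hbd'] with x hx1 hx2
    by_cases hxA : x ∈ A
    · exact crossKernel_univ_of_mem κ hA hxA
    · refine (crossKernel_univ_of_notMem κ hA hxA).trans ?_
      have hxi : x ∈ interior Aᶜ := by
        rw [interior_compl]
        intro hcl
        exact hx1 ⟨hcl, fun hi => hxA (interior_subset hi)⟩
      refine measure_mono_null ?_ (measure_union_null (hcon x hxi)
        (measure_eq_zero_iff_ae_notMem.2 hx2))
      intro y hy
      by_cases hyi : y ∈ interior A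
      · exact Or.inl hyi
      · exact Or.inr ⟨subset_closure hy, hyi⟩
  -- `w` is a point of the interior of `A` whose neighbourhoods are all charged by the jump from
  -- `x`. Starting points near `x` then jump near `w` with probability bounded below, so the finite
  -- crossing mass bounds `m` near `x`.
  obtain ⟨w, hwA, hw⟩ := exists_mem_forall_mem_nhdsWithin_pos_measure hx
  obtain ⟨O₁, O₂, hO₁, hO₂, hxO, hwO, hq⟩ := hfin x (interior_subset hxA) w (interior_subset hwA)
  obtain ⟨U', W, hU', hW, huU', hW0, hsub⟩ :
      ∃ U' W : Set G, IsOpen U' ∧ IsOpen W ∧ w ∈ U' ∧ (0 : G) ∈ W ∧ U' ×ˢ W ⊆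
        (fun q : G × G => q.1 + q.2) ⁻¹' (O₂ ∩ interior A) :=
    isOpen_prod_iff.1 ((hO₂.inter isOpen_interior).preimage continuous_add) w 0
      (show w + 0 ∈ O₂ ∩ interior A by rw [add_zero]; exact ⟨hwO, hwA⟩)
  have hε : κ x U' ≠ 0 := (hw U' (mem_nhdsWithin_of_mem_nhds (hU'.mem_nhds huU'))).ne'
  set V : Set G := {y | y - x ∈ W} ∩ (O₁ ∩ interior Aᶜ) with hVdef
  have hV : IsOpen V := (hW.preimage (continuous_id.sub continuous_const)).inter
    (hO₁.inter isOpen_interior)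
  have hVne : V.Nonempty := ⟨x, ⟨by simpa using hW0, hxO, hxA⟩⟩
  refine hp.eq_smul_of_open μ hm hV hVne ?_
  have hm0 : MeasurableSet (O₂ ∩ A) := hO₂.measurableSet.inter hA
  have h2 : κ x U' * m V ≤ ∫⁻ y in O₁ ∩ Aᶜ, κ y (O₂ ∩ A) ∂m := by
    calc κ x U' * m V = ∫⁻ _ in V, κ x U' ∂m := by rw [setLIntegral_const]
      _ ≤ ∫⁻ y in V, κ y (O₂ ∩ A) ∂m := by
          refine setLIntegral_mono (Kernel.measurable_coe _ hm0) fun y hy => ?_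
          have := translationKernel_pow_le_of_near p 1
            (hO₂.inter isOpen_interior).measurableSet hsub hy.1
          rw [pow_one] at this
          exact this.trans (measure_mono (inter_subset_inter_right _ interior_subset))
      _ ≤ _ := lintegral_mono_set fun y (hy : y ∈ V) =>
          (⟨hy.2.1, interior_subset hy.2.2⟩ : y ∈ O₁ ∩ Aᶜ)
  by_contra hcon
  rw [not_lt, top_le_iff] at hcon
  rw [hcon, ENNReal.mul_top hε, top_le_iff] at h2
  exact hq.ne h2

end Group

/-! ### Local finiteness under restriction and extension -/

section LocallyFinite

variable {X : Type*} [MeasurableSpace X] [TopologicalSpace X] {S : Set X}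

theorem isLocallyFiniteMeasure_comap_val (hS : MeasurableSet S) {m μ : Measure X}
    [IsLocallyFiniteMeasure μ] (h : m ≤ μ) :
    IsLocallyFiniteMeasure (m.comap (Subtype.val : S → X)) := by
  refine ⟨fun a => ?_⟩
  obtain ⟨O, ha, hO, hfin⟩ := μ.exists_isOpen_measure_lt_top a.1
  refine ⟨Subtype.val ⁻¹' O, (hO.preimage continuous_subtype_val).mem_nhds ha, ?_⟩
  rw [(MeasurableEmbedding.subtype_coe hS).comap_apply]
  exact (measure_mono (image_preimage_subset _ _)).trans_lt ((h O).trans_lt hfin)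

theorem exists_isOpen_map_val_lt_top (hS : MeasurableSet S) (η : Measure S)
    [IsLocallyFiniteMeasure η] {x : X} (hx : x ∈ S) :
    ∃ O : Set X, IsOpen O ∧ x ∈ O ∧ η.map Subtype.val O < ∞ := by
  obtain ⟨s, hxs, hs, hfin⟩ := η.exists_isOpen_measure_lt_top ⟨x, hx⟩
  obtain ⟨O, hO, rfl⟩ := isOpen_induced_iff.1 hs
  refine ⟨O, hO, hxs, ?_⟩
  rwa [(MeasurableEmbedding.subtype_coe hS).map_apply]

theorem eq_smul_comap_val (hS : MeasurableSet S) {η : Measure S} {m : Measure X} {c : ℝ≥0}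
    (h : η.map Subtype.val = c • m) : η = c • m.comap Subtype.val := by
  rw [← (MeasurableEmbedding.subtype_coe hS).comap_map η, h]
  ext s hs
  rw [(MeasurableEmbedding.subtype_coe hS).comap_apply, Measure.smul_apply, Measure.smul_apply,
    (MeasurableEmbedding.subtype_coe hS).comap_apply]

end LocallyFinite

/-! ### The entrance and exit statements for the walk -/

section Walk

variable {G : Type*} [AddCommGroup G] [TopologicalSpace G] [IsTopologicalAddGroup G]
  [MeasurableSpace G] [BorelSpace G] [SecondCountableTopology G] [LocallyCompactSpace G]
  [T2Space G] {p : Measure G} [IsProbabilityMeasure p] (μ : Measure G) [μ.IsAddHaarMeasure]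
  {A : Set G} (hA : MeasurableSet A)

theorem bind_smul_measure {X : Type*} [MeasurableSpace X] (c : ℝ≥0) (m : Measure X)
    (κ : Kernel X X) : (c • m).bind κ = c • m.bind κ := by
  refine Measure.ext_of_lintegral _ fun f hf => ?_
  rw [lintegral_bind_kernel _ _ hf, lintegral_smul_measure, lintegral_smul_measure,
    lintegral_bind_kernel _ _ hf]

theorem IsRecurrentStep.isUniquelyInvariant_entrance (hp : IsRecurrentStep p)
    (h0 : μ A ≠ 0) (h1 : μ Aᶜ ≠ 0) (hbd : μ (frontier A) = 0) :
    IsUniquelyInvariant (entranceKernel (translationKernel p) hA)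
      (entranceMeasure (translationKernel p) μ A) := by
  set P := translationKernel p with hP
  have hL := hp.isLiouville μ
  refine ⟨?_, ?_, hL.isInvariant_entrance hA h0 h1, ?_⟩
  · intro hz
    refine hL.bind_crossKernel_ne_zero hA h0 h1 ?_
    rw [← map_comap_val hA (bind_crossKernel_compl P hA μ), ← entranceMeasure_eq hA, hz,
      Measure.map_zero]
  · rw [entranceMeasure_eq hA]
    refine isLocallyFiniteMeasure_comap_val hA (μ := μ) ?_
    conv_rhs => rw [← hL.bind_eq, ← bind_stay_add_cross P hA]
    exact Measure.le_add_left le_rfl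
  · intro η _ hη
    rw [isInvariant_entranceKernel_iff] at hη
    obtain ⟨c, hc⟩ := hp.eq_smul_of_crossing μ hA h0 h1 hbd (bind_eq_of_bind_green hA _ hη) (by
      intro x hx w hw
      obtain ⟨O, hO, hwO, hfin⟩ := exists_isOpen_map_val_lt_top hA η hw
      -- The crossings of m = ηG have landing distribution mC = η, so a neighbourhood of the landing
      -- point controls them and no restriction on the starting point is needed.
      refine ⟨univ, O, isOpen_univ, hO, mem_univ _, hwO, lt_of_le_of_lt ?_ hfin⟩
      conv_rhs => rw [← hη, Measure.bind_apply hO.measurableSet (Kernel.measurable _).aemeasurable]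
      refine le_trans (le_of_eq ?_) (setLIntegral_le_lintegral (univ ∩ Aᶜ) _)
      refine setLIntegral_congr_fun (MeasurableSet.univ.inter hA.compl) fun y hy => ?_
      rw [crossKernel_of_notMem P hA hy.2, Measure.restrict_apply hO.measurableSet])
    refine ⟨c, ?_⟩
    rw [entranceMeasure_eq hA]
    refine eq_smul_comap_val hA ?_
    rw [← bind_smul_measure, ← hc, hη]

theorem IsRecurrentStep.isUniquelyInvariant_exit (hp : IsRecurrentStep p)
    (h0 : μ A ≠ 0) (h1 : μ Aᶜ ≠ 0) (hbd : μ (frontier A) = 0) :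
    IsUniquelyInvariant (exitKernel (translationKernel p) hA)
      (exitMeasure (translationKernel p) μ A) := by
  set P := translationKernel p with hP
  have hL := hp.isLiouville μ
  have hAc := hA.compl
  refine ⟨?_, ?_, hL.isInvariant_exit hA h0 h1, ?_⟩
  · intro hz
    refine hL.bind_crossKernel_ne_zero hA h0 h1 ?_
    rw [← exitDensity_bind_condKernel, ← map_comap_val hAc (exitDensity_compl_compl hA μ),
      ← exitMeasure_eq hA, hz, Measure.map_zero, Measure.bind_zero_left]
  · rw [exitMeasure_eq hA]
    refine isLocallyFiniteMeasure_comap_val hAc (μ := μ) ?_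
    conv_rhs => rw [← withDensity_one (μ := μ)]
    exact withDensity_mono (Filter.Eventually.of_forall (crossKernel_univ_le_one P hA))
  · intro η _ hη
    rw [isInvariant_exitKernel_iff] at hη
    -- Applying the conditioned jump J to the invariance of η gives (ηJ)GC = ηJ, so ηJ satisfies the
    -- entrance equation and (ηJ)G is P-invariant.
    have hζ := exitDensity_bind_condKernel P hA
      (((η.map Subtype.val).bind (condKernel P hA)).bind (greenKernel (stayKernel P hA)))
    rw [hη] at hζ
    obtain ⟨c, hc⟩ := hp.eq_smul_of_crossing μ hA h0 h1 hbd
      (bind_eq_of_bind_green hA _ hζ.symm) (by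
        intro x hx w hw
        obtain ⟨O, hO, hxO, hfin⟩ := exists_isOpen_map_val_lt_top hAc η (x := x) hx
        -- The roles are exchanged for the exit chain: η is the distribution of the starting points
        -- of crossings, so the neighbourhood is taken there.
        refine ⟨O, univ, hO, isOpen_univ, hxO, mem_univ _, lt_of_le_of_lt ?_ hfin⟩
        conv_rhs => rw [← hη, exitDensity, withDensity_apply _ hO.measurableSet]
        refine le_trans (le_of_eq ?_) (lintegral_mono_set (inter_subset_left (t := Aᶜ)))
        refine setLIntegral_congr_fun (hO.measurableSet.inter hA.compl) fun y hy => ?_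
        rw [crossKernel_univ_of_notMem P hA hy.2, univ_inter])
    refine ⟨c, ?_⟩
    rw [exitMeasure_eq hA]
    refine eq_smul_comap_val hAc ?_
    rw [← hη, hc]
    ext s hs
    rw [exitDensity, exitDensity, withDensity_apply _ hs, Measure.smul_apply,
      withDensity_apply _ hs, Measure.restrict_smul, lintegral_smul_measure]

theorem IsLiouville.isRecurrent_isErgodic_entrance {X : Type*} [MeasurableSpace X]
    {P : Kernel X X} [IsMarkovKernel P] {μ : Measure X} [SigmaFinite μ] (h : IsLiouville P μ)
    {A : Set X} (hA : MeasurableSet A) (h0 : μ A ≠ 0) (h1 : μ Aᶜ ≠ 0) :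
    IsRecurrent (entranceKernel P hA) (entranceMeasure P μ A) ∧
      IsErgodic (entranceKernel P hA) (entranceMeasure P μ A) := by
  have hinv := bind_map_inl (h.isInvariant_entrance hA h0 h1) (h.ae_entrance_cemetery hA h0 h1)
  have hc := h.excessiveConst_entrance hA h0 h1
  exact ⟨isRecurrent_of_excessiveConst hinv hc, ergodic_of_excessiveConst hinv hc⟩

theorem IsLiouville.isRecurrent_isErgodic_exit {X : Type*} [MeasurableSpace X]
    {P : Kernel X X} [IsMarkovKernel P] {μ : Measure X} [SigmaFinite μ] (h : IsLiouville P μ)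
    {A : Set X} (hA : MeasurableSet A) (h0 : μ A ≠ 0) (h1 : μ Aᶜ ≠ 0) :
    IsRecurrent (exitKernel P hA) (exitMeasure P μ A) ∧
      IsErgodic (exitKernel P hA) (exitMeasure P μ A) := by
  have hinv := bind_map_inl (h.isInvariant_exit hA h0 h1) (h.ae_exit_cemetery hA h0 h1)
  have hc := h.excessiveConst_exit hA h0 h1
  exact ⟨isRecurrent_of_excessiveConst hinv hc, ergodic_of_excessiveConst hinv hc⟩

end Walk

/-! ### From topological recurrence on the state space to the abstract hypotheses -/

section StateSpace

variable {d : ℕ} (ρ : Measure (EuclideanSpace ℝ (Fin d))) [IsProbabilityMeasure ρ]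

theorem isClosed_stateSpace :
    IsClosed (stateSpace ρ : Set (EuclideanSpace ℝ (Fin d))) :=
  AddSubgroup.isClosed_topologicalClosure _

instance : LocallyCompactSpace (stateSpace ρ) :=
  (isClosed_stateSpace ρ).isClosedEmbedding_subtypeVal.locallyCompactSpace

theorem walkKernel_eq : walkKernel ρ = translationKernel (stepLaw ρ) := rfl

theorem lintegral_chainLaw_eval {E : Type*} [MeasurableSpace E] (P : Kernel E E)
    [IsMarkovKernel P] (n : ℕ) (x : E) {f : E → ℝ≥0∞} (hf : Measurable f) :
    ∫⁻ ω, f (ω n) ∂(chainLaw P x) = ∫⁻ y, f y ∂((P ^ n) x) := by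
  have hm : ∀ n, Measurable fun ω : ℕ → E => f (ω n) := fun n => hf.comp (measurable_pi_apply n)
  induction n generalizing x with
  | zero =>
    rw [lintegral_congr_ae (ae_chainLaw_zero P x hf), lintegral_pow_zero P x hf]
    simp
  | succ n ih =>
    rw [lintegral_chainLaw P x (hm (n + 1)), lintegral_pow_succ P n x hf]
    exact lintegral_congr fun y => ih y

theorem chainLaw_eval {E : Type*} [MeasurableSpace E] (P : Kernel E E)
    [IsMarkovKernel P] (n : ℕ) (x : E) {s : Set E} (hs : MeasurableSet s) :
    chainLaw P x {ω | ω n ∈ s} = (P ^ n) x s := by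
  rw [← lintegral_indicator_one hs,
    ← lintegral_chainLaw_eval P n x (measurable_one.indicator hs),
    ← lintegral_indicator_one (s := {ω : ℕ → E | ω n ∈ s})
      (measurable_pi_apply (X := fun _ => E) n hs)]
  rfl

theorem isRecurrentStep_stepLaw (hrec : IsTopologicallyRecurrent ρ) :
    IsRecurrentStep (stepLaw ρ) := by
  constructor
  · intro V hV h0
    by_contra hne
    rw [← walkKernel_eq, greenKernel, Kernel.sum_apply' _ _ hV.measurableSet] at hne
    simp_rw [← chainLaw_eval (walkKernel ρ) _ _ hV.measurableSet] at hne
    -- By Borel–Cantelli, a finite Green measure of `V` would allow only finitely many visits to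
    -- `V`, against topological recurrence.
    have h1 := measure_setOfPred_frequently_eq_zero hne
    have h2 := hrec V hV h0
    have h3 : ∀ᵐ ω ∂(chainLaw (walkKernel ρ) 0), False := by
      filter_upwards [h2, measure_eq_zero_iff_ae_notMem.1 h1] with ω hω hω'
      exact hω' hω
    exact (inferInstance : (ae (chainLaw (walkKernel ρ) 0)).NeBot).ne
      (Filter.eventually_false_iff_eq_bot.1 h3)
  · intro H hH hHp
    have hcl : IsClosed
        ((H.map (stateSpace ρ).subtype : AddSubgroup _) : Set (EuclideanSpace ℝ (Fin d))) :=
      (isClosed_stateSpace ρ).isClosedEmbedding_subtypeVal.isClosedMap _ hH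
    have hZ0 : ρ (stateSpace ρ : Set (EuclideanSpace ℝ (Fin d)))ᶜ = 0 := by
      refine measure_mono_null (compl_subset_compl.2 ?_) (Measure.support_mem_ae (μ := ρ))
      exact AddSubgroup.subset_closure.trans (AddSubgroup.le_topologicalClosure _)
    have hH0 : ρ (Subtype.val '' (H : Set (stateSpace ρ))ᶜ) = 0 := 
      ((MeasurableEmbedding.subtype_coe (measurableSet_stateSpace ρ)).comap_apply ρ _).symm.trans
        hHp
    have hae : ((H.map (stateSpace ρ).subtype : AddSubgroup _) : Set (EuclideanSpace ℝ (Fin d))) ∈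
        ae ρ := by
      refine mem_ae_iff.2 (measure_mono_null ?_ (measure_union_null hZ0 hH0))
      intro x hx
      by_cases hxZ : x ∈ stateSpace ρ
      · exact Or.inr ⟨⟨x, hxZ⟩, fun hxH => hx ⟨_, hxH, rfl⟩, rfl⟩
      · exact Or.inl hxZ
    -- The image of `H` in the ambient space is a closed subgroup of full measure, so it contains
    -- the support of ρ, and by minimality the whole state space.
    have hle : stateSpace ρ ≤ H.map (stateSpace ρ).subtype := by
      refine AddSubgroup.topologicalClosure_minimal _ ((AddSubgroup.closure_le _).2 ?_) hcl
      exact Measure.support_subset_of_isClosed hcl hae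
    refine (AddSubgroup.eq_top_iff' H).2 fun z => ?_
    obtain ⟨y, hy, hyz⟩ := hle z.2
    have : y = z := Subtype.ext hyz
    exact this ▸ hy

end StateSpace

end EntranceExit

end

theorem theorem5p2 {d : ℕ} (ρ : MeasureTheory.Measure (EuclideanSpace ℝ (Fin d)))
    [IsProbabilityMeasure ρ]
    (hrec : EntranceExit.IsTopologicallyRecurrent ρ)
    (μ : MeasureTheory.Measure (EntranceExit.stateSpace ρ)) [μ.IsAddHaarMeasure]
    (A : Set (EntranceExit.stateSpace ρ)) (hA : MeasurableSet A)
    (hA_pos : μ A ≠ 0) (hAc_pos : μ Aᶜ ≠ 0) (hbd : μ (frontier A) = 0) :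
    (EntranceExit.IsUniquelyInvariant
        (EntranceExit.entranceKernel (EntranceExit.walkKernel ρ) hA)
        (EntranceExit.entranceMeasure (EntranceExit.walkKernel ρ) μ A) ∧
      EntranceExit.IsRecurrent
        (EntranceExit.entranceKernel (EntranceExit.walkKernel ρ) hA)
        (EntranceExit.entranceMeasure (EntranceExit.walkKernel ρ) μ A) ∧
      EntranceExit.IsErgodic
        (EntranceExit.entranceKernel (EntranceExit.walkKernel ρ) hA)
        (EntranceExit.entranceMeasure (EntranceExit.walkKernel ρ) μ A)) ∧
    (EntranceExit.IsUniquelyInvariant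
        (EntranceExit.exitKernel (EntranceExit.walkKernel ρ) hA)
        (EntranceExit.exitMeasure (EntranceExit.walkKernel ρ) μ A) ∧
      EntranceExit.IsRecurrent
        (EntranceExit.exitKernel (EntranceExit.walkKernel ρ) hA)
        (EntranceExit.exitMeasure (EntranceExit.walkKernel ρ) μ A) ∧
      EntranceExit.IsErgodic
        (EntranceExit.exitKernel (EntranceExit.walkKernel ρ) hA)
        (EntranceExit.exitMeasure (EntranceExit.walkKernel ρ) μ A)) := by
  have hp := EntranceExit.isRecurrentStep_stepLaw ρ hrec
  have hL := hp.isLiouville μ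
  exact ⟨⟨hp.isUniquelyInvariant_entrance μ hA hA_pos hAc_pos hbd,
      hL.isRecurrent_isErgodic_entrance hA hA_pos hAc_pos⟩,
    hp.isUniquelyInvariant_exit μ hA hA_pos hAc_pos hbd,
    hL.isRecurrent_isErgodic_exit hA hA_pos hAc_pos⟩
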